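/- There are universal constants $0<c\le C<\infty$ such that the following holds. Let $P$ be the transition matrix of an irreducible, transitive, reversible and lazy Markov chain on a finite state space $E$ with $n$ elements, and let $\pi$ be its stationary distribution. Here transitive means that for all $x,y\in E$ there is a bijection $\phi:E\to E$ with $\phi(x)=y$ and $P(z,w)=P(\phi(z),\phi(w))$ for all $z,w$; lazy means that $P=(R+I)/2$ for some transition matrix $R$. Let $\lambda_2\ge\dots\ge\lambda_n$ be the non-unit eigenvalues of $P$, listed with multiplicity, and let \[ Q=\sum_{j=2}^n (1-\lambda_j)^{-2}. \] Let $X$ and $Y$ be independent Markov chains with transition matrix $P$, let $\tau_I=\inf\{t\ge 0:\{X_0,\dots,X_t\}\cap\{Y_0,\dots,Y_t\}\ne\emptyset\}$ and $t_I=\max_{x,y\in E}\mathbb E_{x,y}[\tau_I]$, where the subscripts are the starting states of $X$ and $Y$. Write $p_t(x,y)=P^t(x,y)$, let \[ t_{\mathrm{unif}}=\inf\Big\{t\ge 0:\max_{x,y}\Big|\frac{p_t(x,y)}{\pi(y)}-1\Big|\le \tfrac14\Big\}, \] and let $I=\sum_{i=0}^{t_{\mathrm{unif}}}\sum_{j=0}^{t_{\mathrm{unif}}}\mathbf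 1(X_i=Y_j)$. Then \[ c\sqrt Q\le t_I\le C\sqrt Q, \] and, if $n\ge 2$, for every state $x\in E$, \[ c\,n\sum_{i,j=0}^{t_{\mathrm{unif}}}p_{i+j}(x,x)\;\le\; Q\;\le\; C\,n\sum_{i,j=0}^{t_{\mathrm{unif}}}p_{i+j}(x,x) \] and \[ c\sqrt{n\,\mathbb E_{x,x}[I]}\;\le\; t_I\;\le\; C\sqrt{n\,\mathbb E_{x,x}[I]}. \] -/

import Mathlib

open MeasureTheory ProbabilityTheory
open scoped ENNReal

namespace IntersectionTime

section Chain

variable {V : Type*} [Fintype V] [DecidableEq V]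

/-- The probability vector `π` is a stationary distribution of the transition matrix `P`. -/
def IsStationary (P : Matrix.rowStochastic ℝ V) (π : V → ℝ) : Prop :=
  (∀ x, 0 ≤ π x) ∧ ∑ x, π x = 1 ∧ ∀ y, ∑ x, π x * P.1 x y = π y

/-- Reversibility with respect to `π` (detailed balance). -/
def IsReversible (P : Matrix.rowStochastic ℝ V) (π : V → ℝ) : Prop :=
  ∀ x y, π x * P.1 x y = π y * P.1 y x

/-- `P` is the lazy version `(R + I) / 2` of some transition matrix `R`. -/
def IsLazy (P : Matrix.rowStochastic ℝ V) : Prop :=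
  ∃ R : Matrix.rowStochastic ℝ V, P.1 = (1 / 2 : ℝ) • (R.1 + 1)

/-- Any state can be moved to any other one by a bijection that preserves the transition
probabilities. -/
def IsTransitive (P : Matrix.rowStochastic ℝ V) : Prop :=
  ∀ x y, ∃ φ : V ≃ V, φ x = y ∧ ∀ z w, P.1 z w = P.1 (φ z) (φ w)

/-- The `t`-step transition probability `p_t(x, y)`. -/
def stepProb (P : Matrix.rowStochastic ℝ V) (t : ℕ) (x y : V) : ℝ := (P.1 ^ t) x y

/-- The uniform mixing time of a chain with stationary distribution `π`. -/
noncomputable def unifMixingTime (P : Matrix.rowStochastic ℝ V) (π : V → ℝ) : ℕ :=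
  sInf {t : ℕ | ∀ x y, |stepProb P t x y / π y - 1| ≤ 1 / 4}

open Classical in
/-- The non-unit real eigenvalues of `P`, repeated according to their multiplicity.
(All eigenvalues of a reversible chain are real.) -/
noncomputable def nonUnitEigenvalues (P : Matrix.rowStochastic ℝ V) : Multiset ℝ :=
  P.1.charpoly.roots.filter (fun l => l ≠ 1)

/-- `Q = ∑_{j ≥ 2} (1 - λ_j)⁻²`. -/
noncomputable def spectralSum (P : Matrix.rowStochastic ℝ V) : ℝ :=
  ((nonUnitEigenvalues P).map (fun l => ((1 - l) ^ 2)⁻¹)).sum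

end Chain

section Law

variable {V : Type*} [Fintype V] [DecidableEq V] [MeasurableSpace V] [DiscreteMeasurableSpace V]

/-- The one-step kernel `x ↦ P(x, ·)`. -/
noncomputable def stepKernel (P : Matrix.rowStochastic ℝ V) : Kernel V V :=
  Kernel.ofFunOfCountable fun x => ∑ y, ENNReal.ofReal (P.1 x y) • Measure.dirac y

instance (P : Matrix.rowStochastic ℝ V) : IsMarkovKernel (stepKernel P) where
  isProbabilityMeasure x := ⟨by
    have h : stepKernel P x = ∑ y, ENNReal.ofReal (P.1 x y) • Measure.dirac y := rfl
    rw [h]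
    simp only [Measure.coe_finsetSum, Measure.coe_smul, Finset.sum_apply, Pi.smul_apply,
      measure_univ, smul_eq_mul, mul_one]
    rw [← ENNReal.ofReal_sum_of_nonneg
      (fun y _ => Matrix.nonneg_of_mem_rowStochastic P.2),
      Matrix.sum_row_of_mem_rowStochastic P.2, ENNReal.ofReal_one]⟩

/-- The conditional law of `X_{n+1}` given the past `(X_0, …, X_n)`. -/
noncomputable def historyKernel (P : Matrix.rowStochastic ℝ V) (n : ℕ) :
    Kernel (Finset.Iic n → V) V :=
  (stepKernel P).comap (fun h => h ⟨n, Finset.mem_Iic.2 le_rfl⟩) (measurable_pi_apply _)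

instance (P : Matrix.rowStochastic ℝ V) (n : ℕ) : IsMarkovKernel (historyKernel P n) := by
  unfold historyKernel
  infer_instance

/-- The law on the space of trajectories of the Markov chain with transition matrix `P`
started from `x`. -/
noncomputable def chainLaw (P : Matrix.rowStochastic ℝ V) (x : V) : Measure (ℕ → V) :=
  Kernel.traj (X := fun _ => V) (historyKernel P) 0 (fun _ => x)

/-- The joint law of two independent copies of the chain, started from `x` and from `y`. -/
noncomputable def pairLaw (P : Matrix.rowStochastic ℝ V) (x y : V) :
    Measure ((ℕ → V) × (ℕ → V)) :=
  (chainLaw P x).prod (chainLaw P y)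

/-- `τ_I = inf {t ≥ 0 : {X_0, …, X_t} ∩ {Y_0, …, Y_t} ≠ ∅}`, infinite if there is no such `t`. -/
noncomputable def firstIntersection (X Y : ℕ → V) : ℝ≥0∞ :=
  ⨅ (t : ℕ) (_ : ((X '' Set.Iic t) ∩ (Y '' Set.Iic t)).Nonempty), (t : ℝ≥0∞)

/-- `t_I = max_{x,y} E_{x,y}[τ_I]`. -/
noncomputable def intersectionTime (P : Matrix.rowStochastic ℝ V) : ℝ≥0∞ :=
  ⨆ (x : V) (y : V), ∫⁻ ω, firstIntersection ω.1 ω.2 ∂(pairLaw P x y)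

/-- The number of pairs `(i, j)` with `0 ≤ i, j ≤ t` and `X_i = Y_j`. -/
def numIntersections (t : ℕ) (X Y : ℕ → V) : ℕ :=
  ∑ i ∈ Finset.range (t + 1), ∑ j ∈ Finset.range (t + 1), if X i = Y j then 1 else 0

/-- `E_{x,x}[I]` for `I` the number of intersections up to time `t`. -/
noncomputable def expectedIntersections (P : Matrix.rowStochastic ℝ V) (t : ℕ) (x : V) : ℝ≥0∞ :=
  ∫⁻ ω, (numIntersections t ω.1 ω.2 : ℝ≥0∞) ∂(pairLaw P x x)

end Law

end IntersectionTime

/-!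
Write `n` for the number of states, `Q = spectralSum P`, and `H t = traceSum P t`, the sum of
`tr P^(i+j)` over `i, j ≤ t`. Transitivity makes the uniform distribution stationary, so that
reversibility means that `P` is symmetric, and it makes `P^k x x` independent of `x`, so that
`H t = n ∑_{i, j ≤ t} p_{i+j}(x, x) = n E_{x,x}[I]`. Spectrally,
`H t = (t+1)² + ∑_{i ≥ 2} ((1 - λ_i^(t+1)) / (1 - λ_i))²`, and laziness puts all `λ_i` in `[0, 1]`.
The uniform distance to stationarity at time `t` is exactly `tr P^t - 1 = ∑_{i ≥ 2} λ_i^t`. From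
`s λ^s (1 - λ) ≤ 1` it is at most `1/4` as soon as `t = 2s` with `s² ≥ 4Q`, so the mixing time is
`O(√Q)`, and at the mixing time `Q` and `H` are comparable (`IsSpectrum.spectralSum_le_traceSum`,
`IsSpectrum.traceSum_le_spectralSum`).

*Upper bound for the intersection time.* The second moment of the number `I_t` of intersections up to
time `t`, from stationary starting points, is at most `4 (t+1)² H t / n²`
(`sum_pairExp_interCount_sq_le`), while the first moment is `(t+1)² / n`. By Cauchy-Schwarz,
stationary chains intersect by time `t` with probability at least `(t+1)² / (4 H t)`, which is at
least `1/8` when `(t+1)² ≥ Q`. Running the chains first for `O(√Q)` steps to mix, this holds with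
another constant from all starting points (`le_meetProb_of_sq_le`), and the Markov property turns it
into a bound on the expectation (`sum_missProb_le`).

*Lower bound.* If the chains meet at `X_i = Y_j` with `i, j ≤ t`, then the conditional expectation of
`I_{2t}` given `X_0, …, X_i, Y_0, …, Y_j` is at least `H t / n`. There is no first pair of meeting
times, so the strong Markov property is of no use; the substitute is Cairoli's maximal inequality for
two-parameter martingales, that is Doob's `L²` inequality applied once for each chain
(`pairExp_indicator_mul_sq_le`). It bounds the probability of meeting by `(n / H t)²` times the second
moment of `I_{2t}`, hence by a multiple of `(t+1)² / H t` (`sum_meetProb_mul_le`). For `t` about twice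
the intersection time `t_I`, Markov's inequality makes this probability at least `1/2`, so
`H t = O((t+1)²)`. It remains to compare `H t` with `Q`, that is to bound every `λ_i^(t+1)` away
from `1`: chains started at a maximum and at a minimum of an eigenfunction with eigenvalue `λ`
intersect by time `t` with probability at most `3 (1 - λ^t)` (`meetProb_le_of_eigenfunction`).

Expectations of functionals of finitely many steps are computed with the finite recursion `pathExp`,
which `lintegral_chainLaw` identifies with integrals against the law of the chain.
-/

namespace IntersectionTime

/-! ### Finite-horizon expectations over trajectories -/

section PathExp

variable {V : Type*}

/-- The trajectory that starts at `x` and continues along `ω`. -/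
def consPath (x : V) (ω : ℕ → V) : ℕ → V
  | 0 => x
  | n + 1 => ω n

/-- The trajectory that follows `ω` before time `i` and `ω'` (restarted) from time `i` on. -/
def splice (i : ℕ) (ω ω' : ℕ → V) : ℕ → V := fun k => if k < i then ω k else ω' (k - i)

@[simp] lemma consPath_zero (x : V) (ω : ℕ → V) : consPath x ω 0 = x := rfl

@[simp] lemma consPath_succ (x : V) (ω : ℕ → V) (n : ℕ) : consPath x ω (n + 1) = ω n := rfl

lemma splice_zero (ω ω' : ℕ → V) : splice 0 ω ω' = ω' := by
  ext k; simp [splice]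

lemma splice_succ_consPath (i : ℕ) (x : V) (ω ω' : ℕ → V) :
    splice (i + 1) (consPath x ω) ω' = consPath x (splice i ω ω') := by
  ext k
  cases k with
  | zero => simp [splice]
  | succ k => simp [splice]

lemma splice_of_le {i k : ℕ} {ω ω' : ℕ → V} (h : ω' 0 = ω i) (hk : k ≤ i) :
    splice i ω ω' k = ω k := by
  rcases hk.lt_or_eq with hk | rfl
  · simp [splice, hk]
  · simp [splice, h]

@[simp] lemma splice_add (i k : ℕ) (ω ω' : ℕ → V) : splice i ω ω' (i + k) = ω' k := by
  simp [splice]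

variable [Fintype V]

/-- The expectation of `F (X_0, X_1, …)` for the chain with transition matrix `P` started from `x`
and frozen after `n` steps. For a functional of `X_0, …, X_n` this is the expectation under the law
of the chain. -/
def pathExp (P : Matrix V V ℝ) : ℕ → V → ((ℕ → V) → ℝ) → ℝ
  | 0, x, F => F (fun _ => x)
  | n + 1, x, F => ∑ y, P x y * pathExp P n y (fun ω => F (consPath x ω))

variable (P : Matrix V V ℝ)

lemma pathExp_congr (n : ℕ) (x : V) {F G : (ℕ → V) → ℝ} (h : ∀ ω, ω 0 = x → F ω = G ω) :
    pathExp P n x F = pathExp P n x G := by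
  cases n with
  | zero => exact h _ rfl
  | succ n =>
    simp only [pathExp]
    refine Finset.sum_congr rfl fun y _ => ?_
    congr 2
    ext ω
    exact h _ rfl

lemma pathExp_mono {P : Matrix V V ℝ} (hP : ∀ x y, 0 ≤ P x y) (n : ℕ) (x : V)
    {F G : (ℕ → V) → ℝ} (h : ∀ ω, ω 0 = x → F ω ≤ G ω) :
    pathExp P n x F ≤ pathExp P n x G := by
  induction n generalizing x F G with
  | zero => exact h _ rfl
  | succ n ih =>
    simp only [pathExp]
    exact Finset.sum_le_sum fun y _ =>
      mul_le_mul_of_nonneg_left (ih y fun ω _ => h _ rfl) (hP x y)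

lemma pathExp_finsetSum {ι : Type*} (s : Finset ι) (n : ℕ) (x : V) (c : ι → ℝ)
    (F : ι → (ℕ → V) → ℝ) :
    pathExp P n x (fun ω => ∑ i ∈ s, c i * F i ω) = ∑ i ∈ s, c i * pathExp P n x (F i) := by
  induction n generalizing x F with
  | zero => rfl
  | succ n ih =>
    simp only [pathExp]
    simp_rw [ih, Finset.mul_sum]
    rw [Finset.sum_comm]
    refine Finset.sum_congr rfl fun i _ => Finset.sum_congr rfl fun y _ => by ring

lemma pathExp_sum {ι : Type*} (s : Finset ι) (n : ℕ) (x : V) (F : ι → (ℕ → V) → ℝ) :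
    pathExp P n x (fun ω => ∑ i ∈ s, F i ω) = ∑ i ∈ s, pathExp P n x (F i) := by
  simpa using pathExp_finsetSum P s n x (fun _ => 1) F

lemma pathExp_const_mul (n : ℕ) (x : V) (c : ℝ) (F : (ℕ → V) → ℝ) :
    pathExp P n x (fun ω => c * F ω) = c * pathExp P n x F := by
  simpa using pathExp_finsetSum P {()} n x (fun _ => c) (fun _ => F)

lemma pathExp_mul_const (n : ℕ) (x : V) (c : ℝ) (F : (ℕ → V) → ℝ) :
    pathExp P n x (fun ω => F ω * c) = pathExp P n x F * c := by
  simp_rw [mul_comm _ c]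
  exact pathExp_const_mul P n x c F

lemma pathExp_add (n : ℕ) (x : V) (F G : (ℕ → V) → ℝ) :
    pathExp P n x (fun ω => F ω + G ω) = pathExp P n x F + pathExp P n x G := by
  simpa using pathExp_sum P (Finset.univ : Finset Bool) n x (fun b => bif b then F else G)

lemma pathExp_const {P : Matrix V V ℝ} (hP : ∀ x, ∑ y, P x y = 1) (n : ℕ) (x : V) (c : ℝ) :
    pathExp P n x (fun _ => c) = c := by
  induction n generalizing x with
  | zero => rfl
  | succ n ih => simp only [pathExp, ih, ← Finset.sum_mul, hP, one_mul]

lemma pathExp_nonneg {P : Matrix V V ℝ} (hP : ∀ x y, 0 ≤ P x y) (n : ℕ) (x : V)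
    {F : (ℕ → V) → ℝ} (h : ∀ ω, 0 ≤ F ω) : 0 ≤ pathExp P n x F := by
  induction n generalizing x F with
  | zero => exact h _
  | succ n ih => exact Finset.sum_nonneg fun y _ => mul_nonneg (hP x y) (ih y fun ω => h _)

lemma pathExp_comm (n m : ℕ) (x y : V) (F : (ℕ → V) → (ℕ → V) → ℝ) :
    pathExp P n x (fun X => pathExp P m y (fun Y => F X Y))
      = pathExp P m y (fun Y => pathExp P n x (fun X => F X Y)) := by
  induction n generalizing x F with
  | zero => rfl
  | succ n ih =>
    simp only [pathExp]
    rw [pathExp_finsetSum]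
    exact Finset.sum_congr rfl fun z _ => by rw [ih]

/-- The Markov property at time `n`. -/
lemma pathExp_add_eq (n m : ℕ) (x : V) (F : (ℕ → V) → ℝ) :
    pathExp P (n + m) x F
      = pathExp P n x (fun ω => pathExp P m (ω n) (fun ω' => F (splice n ω ω'))) := by
  induction n generalizing x F with
  | zero => simp [pathExp, splice_zero]
  | succ n ih =>
    rw [show n + 1 + m = n + m + 1 by ring]
    simp only [pathExp]
    refine Finset.sum_congr rfl fun y _ => ?_
    rw [ih]
    simp [splice_succ_consPath]

/-- A functional of the first `n + 1` positions does not see the later steps. -/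
lemma pathExp_add_of_dependsOn {P : Matrix V V ℝ} (hP : ∀ x, ∑ y, P x y = 1) (n m : ℕ) (x : V)
    {F : (ℕ → V) → ℝ} (hF : DependsOn F (Set.Iic n)) :
    pathExp P (n + m) x F = pathExp P n x F := by
  rw [pathExp_add_eq]
  refine pathExp_congr P n x fun ω _ => ?_
  rw [pathExp_congr P m (ω n) (G := fun _ => F ω) fun ω' h => hF fun k hk => splice_of_le h hk]
  exact pathExp_const hP m _ _

variable [DecidableEq V]

lemma pathExp_eval {P : Matrix V V ℝ} (hP : ∀ x, ∑ y, P x y = 1) {n i : ℕ} (hi : i ≤ n) (x : V)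
    (f : V → ℝ) : pathExp P n x (fun ω => f (ω i)) = ∑ z, (P ^ i) x z * f z := by
  induction i generalizing n x with
  | zero =>
    rw [pathExp_congr P n x (G := fun _ => f x) fun ω h => by rw [h], pathExp_const hP]
    simp [Matrix.one_apply]
  | succ i ih =>
    obtain ⟨n, rfl⟩ : ∃ m, n = m + 1 := ⟨n - 1, by omega⟩
    simp only [pathExp, consPath_succ]
    simp_rw [ih (Nat.le_of_succ_le_succ hi), pow_succ' P i, Matrix.mul_apply, Finset.mul_sum,
      Finset.sum_mul]
    rw [Finset.sum_comm]
    exact Finset.sum_congr rfl fun z _ => Finset.sum_congr rfl fun y _ => by ring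

lemma pathExp_eval_eval {P : Matrix V V ℝ} (hP : ∀ x, ∑ y, P x y = 1) {n i d : ℕ}
    (hi : i + d ≤ n) (x : V) (f : V → V → ℝ) :
    pathExp P n x (fun ω => f (ω i) (ω (i + d)))
      = ∑ z, (P ^ i) x z * ∑ w, (P ^ d) z w * f z w := by
  obtain ⟨m, rfl⟩ : ∃ m, n = i + m := ⟨n - i, by omega⟩
  rw [pathExp_add_eq]
  rw [← pathExp_eval hP (le_refl i) x (fun z => ∑ w, (P ^ d) z w * f z w)]
  refine pathExp_congr P i x fun ω _ => ?_
  rw [← pathExp_eval hP (show d ≤ m by omega) (ω i) (f (ω i))]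
  refine pathExp_congr P m _ fun ω' h => ?_
  rw [splice_add, splice_of_le h le_rfl]

/-- The expectation of a functional of the trajectory after time `m`. -/
lemma pathExp_shift {P : Matrix V V ℝ} (hP : ∀ x, ∑ y, P x y = 1) (m n : ℕ) (x : V)
    (F : (ℕ → V) → ℝ) :
    pathExp P (m + n) x (fun ω => F (fun k => ω (m + k)))
      = ∑ z, (P ^ m) x z * pathExp P n z F := by
  rw [pathExp_add_eq, ← pathExp_eval hP (le_refl m) x (fun z => pathExp P n z F)]
  simp

end PathExp

/-! ### Maximal inequalities -/

section Maximal

variable {V : Type*} [Fintype V]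

/-- The maximum of `s` and of the martingale `E[Z | X_0, …, X_i]`, `0 ≤ i ≤ n`, evaluated along the
trajectory `ω`. -/
def runMax (P : Matrix V V ℝ) : ℕ → ℝ → ((ℕ → V) → ℝ) → (ℕ → V) → ℝ
  | 0, s, Z, ω => max s (Z (fun _ => ω 0))
  | n + 1, s, Z, ω => runMax P n (max s (pathExp P (n + 1) (ω 0) Z))
      (fun ω' => Z (consPath (ω 0) ω')) (fun k => ω (k + 1))

variable (P : Matrix V V ℝ)

lemma le_runMax (n : ℕ) (s : ℝ) (Z : (ℕ → V) → ℝ) (ω : ℕ → V) : s ≤ runMax P n s Z ω := by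
  induction n generalizing s Z ω with
  | zero => exact le_max_left _ _
  | succ n ih => exact (le_max_left _ _).trans (ih _ _ _)

lemma pathExp_splice_le_runMax (i m : ℕ) (s : ℝ) (Z : (ℕ → V) → ℝ) (ω : ℕ → V) :
    pathExp P m (ω i) (fun ω' => Z (splice i ω ω')) ≤ runMax P (i + m) s Z ω := by
  induction i generalizing s Z ω with
  | zero =>
    simp only [splice_zero, zero_add]
    cases m with
    | zero => exact le_max_right _ _
    | succ m => exact (le_max_right _ _).trans (le_runMax P _ _ _ _)
  | succ i ih =>
    rw [show i + 1 + m = i + m + 1 by ring]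
    refine le_trans (le_of_eq ?_) (ih _ _ _)
    refine pathExp_congr P m _ fun ω' _ => ?_
    rw [← splice_succ_consPath]
    congr 2
    ext k
    cases k <;> rfl

section

variable [DecidableEq V]

/-- Doob's `L²` maximal inequality, with the running maximum started at `s`. The correction terms
make the induction over the horizon close: raising the running maximum `u` to a larger current value
`m` of the martingale does not increase `2 u² - 4 u m`, which is affine in `m` as long as `u` stays. -/
lemma pathExp_runMax_sq_le_aux {P : Matrix V V ℝ} (hP : P ∈ Matrix.rowStochastic ℝ V) (n : ℕ)
    (x : V) (s : ℝ) (Z : (ℕ → V) → ℝ) :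
    pathExp P n x (fun ω => runMax P n s Z ω ^ 2)
      ≤ 4 * pathExp P n x (fun ω => Z ω ^ 2) + 2 * max s (pathExp P n x Z) ^ 2
        - 4 * max s (pathExp P n x Z) * pathExp P n x Z := by
  induction n generalizing x s Z with
  | zero =>
    simp only [pathExp, runMax]
    nlinarith [sq_nonneg (2 * Z (fun _ => x) - max s (Z fun _ => x))]
  | succ n ih =>
    set u := max s (pathExp P (n + 1) x Z) with hu
    have key : ∀ y, pathExp P n y (fun ω => runMax P (n + 1) s Z (consPath x ω) ^ 2)
        ≤ 4 * pathExp P n y (fun ω => Z (consPath x ω) ^ 2) + 2 * u ^ 2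
          - 4 * u * pathExp P n y (fun ω => Z (consPath x ω)) := by
      intro y
      refine (ih y u fun ω => Z (consPath x ω)).trans ?_
      rcases le_total (pathExp P n y fun ω => Z (consPath x ω)) u with h | h
      · rw [max_eq_left h]
      · rw [max_eq_right h]
        nlinarith [sq_nonneg (u - pathExp P n y fun ω => Z (consPath x ω))]
    calc pathExp P (n + 1) x (fun ω => runMax P (n + 1) s Z ω ^ 2)
        ≤ ∑ y, P x y * (4 * pathExp P n y (fun ω => Z (consPath x ω) ^ 2) + 2 * u ^ 2
          - 4 * u * pathExp P n y (fun ω => Z (consPath x ω))) :=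
          Finset.sum_le_sum fun y _ => mul_le_mul_of_nonneg_left (key y) (hP.1 x y)
      _ = 4 * (∑ y, P x y * pathExp P n y (fun ω => Z (consPath x ω) ^ 2))
          + 2 * u ^ 2 * ∑ y, P x y
          - 4 * u * (∑ y, P x y * pathExp P n y (fun ω => Z (consPath x ω))) := by
          simp only [Finset.mul_sum, ← Finset.sum_add_distrib, ← Finset.sum_sub_distrib]
          exact Finset.sum_congr rfl fun y _ => by ring
      _ = _ := by
          rw [Matrix.sum_row_of_mem_rowStochastic hP, mul_one]
          rfl

/-- Doob's `L²` maximal inequality. -/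
lemma pathExp_runMax_sq_le {P : Matrix V V ℝ} (hP : P ∈ Matrix.rowStochastic ℝ V) (n : ℕ)
    (x : V) {Z : (ℕ → V) → ℝ} (hZ : ∀ ω, 0 ≤ Z ω) :
    pathExp P n x (fun ω => runMax P n 0 Z ω ^ 2) ≤ 4 * pathExp P n x (fun ω => Z ω ^ 2) := by
  have h := pathExp_runMax_sq_le_aux hP n x 0 Z
  rw [max_eq_right (pathExp_nonneg hP.1 n x hZ)] at h
  nlinarith [sq_nonneg (pathExp P n x Z)]

end

/-- The expectation of a functional of two independent chains, started from `x` and from `y`. -/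
def pairExp (P : Matrix V V ℝ) (n : ℕ) (x y : V) (F : (ℕ → V) → (ℕ → V) → ℝ) : ℝ :=
  pathExp P n x (fun X => pathExp P n y (fun Y => F X Y))

lemma pairExp_mono {P : Matrix V V ℝ} (hP : ∀ x y, 0 ≤ P x y) (n : ℕ) (x y : V)
    {F G : (ℕ → V) → (ℕ → V) → ℝ} (h : ∀ X Y, X 0 = x → Y 0 = y → F X Y ≤ G X Y) :
    pairExp P n x y F ≤ pairExp P n x y G :=
  pathExp_mono hP n x fun X hX => pathExp_mono hP n y fun Y hY => h X Y hX hY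

lemma pairExp_sum {ι : Type*} (s : Finset ι) (n : ℕ) (x y : V)
    (F : ι → (ℕ → V) → (ℕ → V) → ℝ) :
    pairExp P n x y (fun X Y => ∑ i ∈ s, F i X Y) = ∑ i ∈ s, pairExp P n x y (F i) := by
  simp only [pairExp, pathExp_sum]

variable [DecidableEq V]

/-- Cairoli's two-parameter maximal inequality: if, whenever the event `A` holds, the conditional
expectation of `Z` given `X_0, …, X_i, Y_0, …, Y_j` is at least `g` for some pair of times `(i, j)`
in the time window, then `P(A) g² ≤ 16 E[Z²]`. It is Doob's inequality applied twice, once for each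
of the two chains. -/
lemma pairExp_indicator_mul_sq_le {P : Matrix V V ℝ} (hP : P ∈ Matrix.rowStochastic ℝ V) (n : ℕ)
    (x y : V) {Z : (ℕ → V) → (ℕ → V) → ℝ} (hZ : ∀ X Y, 0 ≤ Z X Y)
    (A : (ℕ → V) → (ℕ → V) → Prop) [∀ X Y, Decidable (A X Y)] {g : ℝ} (hg : 0 ≤ g)
    (h : ∀ X Y, A X Y → ∃ i k j l, i + k = n ∧ j + l = n ∧ g ≤ pathExp P l (Y j) (fun Y' =>
      pathExp P k (X i) (fun X' => Z (splice i X X') (splice j Y Y')))) :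
    pairExp P n x y (fun X Y => if A X Y then 1 else 0) * g ^ 2
      ≤ 16 * pairExp P n x y (fun X Y => Z X Y ^ 2) := by
  -- the maximum over the first chain, and then the maximum over both
  set W : (ℕ → V) → (ℕ → V) → ℝ := fun X Y => runMax P n 0 (fun X' => Z X' Y) X with hW
  set U : (ℕ → V) → (ℕ → V) → ℝ := fun X Y => runMax P n 0 (fun Y' => W X Y') Y with hU
  have hAU : ∀ X Y, (if A X Y then 1 else 0) * g ^ 2 ≤ U X Y ^ 2 := by
    intro X Y
    split_ifs with hA
    · obtain ⟨i, k, j, l, hik, hjl, hle⟩ := h X Y hA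
      have h1 : g ≤ U X Y := by
        refine hle.trans (le_trans ?_ (hjl ▸ pathExp_splice_le_runMax P j l 0 (fun Y' => W X Y') Y))
        refine pathExp_mono hP.1 l _ fun Y' _ => ?_
        have h2 := pathExp_splice_le_runMax P i k 0 (fun X' => Z X' (splice j Y Y')) X
        rwa [hik] at h2
      rw [one_mul]
      exact pow_le_pow_left₀ hg h1 2
    · rw [zero_mul]
      positivity
  calc pairExp P n x y (fun X Y => if A X Y then 1 else 0) * g ^ 2
      = pairExp P n x y (fun X Y => (if A X Y then 1 else 0) * g ^ 2) := by
        simp only [pairExp, pathExp_mul_const]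
    _ ≤ pairExp P n x y (fun X Y => U X Y ^ 2) := pairExp_mono hP.1 n x y fun X Y _ _ => hAU X Y
    _ ≤ pathExp P n x (fun X => 4 * pathExp P n y (fun Y => W X Y ^ 2)) :=
        pathExp_mono hP.1 n x fun X _ => pathExp_runMax_sq_le hP n y fun Y => le_runMax P _ _ _ _
    _ = 4 * pathExp P n y (fun Y => pathExp P n x (fun X => W X Y ^ 2)) := by
        rw [pathExp_const_mul, pathExp_comm]
    _ ≤ 4 * pathExp P n y (fun Y => 4 * pathExp P n x (fun X => Z X Y ^ 2)) := by
        refine mul_le_mul_of_nonneg_left ?_ (by norm_num)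
        exact pathExp_mono hP.1 n y fun Y _ => pathExp_runMax_sq_le hP n x fun X => hZ X Y
    _ = 16 * pairExp P n x y (fun X Y => Z X Y ^ 2) := by
        rw [pathExp_const_mul, pathExp_comm, pairExp]
        ring

end Maximal

/-! ### Moments of the number of intersections -/

section Moments

variable {V : Type*} [DecidableEq V]

/-- The number of pairs of times up to `t` at which the two trajectories agree, as a real number. -/
def interCount (t : ℕ) (X Y : ℕ → V) : ℝ :=
  ∑ i ∈ Finset.range (t + 1), ∑ j ∈ Finset.range (t + 1), if X i = Y j then 1 else 0

lemma interCount_nonneg (t : ℕ) (X Y : ℕ → V) : 0 ≤ interCount t X Y :=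
  Finset.sum_nonneg fun i _ => Finset.sum_nonneg fun j _ => by positivity

variable [Fintype V]

/-- `∑_{i, j ≤ t} tr P^(i+j)`, which is the number of states times the diagonal Green sum
`∑_{i, j ≤ t} p_{i+j}(x, x)` when the latter does not depend on `x`. -/
def traceSum (P : Matrix V V ℝ) (t : ℕ) : ℝ :=
  ∑ i ∈ Finset.range (t + 1), ∑ j ∈ Finset.range (t + 1), (P ^ (i + j)).trace

variable {P : Matrix V V ℝ}

lemma sum_row_pow (hP : P ∈ Matrix.rowStochastic ℝ V) (k : ℕ) (x : V) : ∑ y, (P ^ k) x y = 1 :=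
  Matrix.sum_row_of_mem_rowStochastic (pow_mem hP k) x

lemma pow_apply_comm (hS : P.IsSymm) (k : ℕ) (x y : V) : (P ^ k) x y = (P ^ k) y x :=
  (hS.pow k).apply y x

lemma sum_col_pow (hP : P ∈ Matrix.rowStochastic ℝ V) (hS : P.IsSymm) (k : ℕ) (y : V) :
    ∑ x, (P ^ k) x y = 1 := by
  simp_rw [fun x => pow_apply_comm hS k x y]
  exact sum_row_pow hP k y

lemma pairExp_eval_eq (hP : P ∈ Matrix.rowStochastic ℝ V) (hS : P.IsSymm) {n i j : ℕ}
    (hi : i ≤ n) (hj : j ≤ n) (x y : V) :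
    pairExp P n x y (fun X Y => if X i = Y j then 1 else 0) = (P ^ (i + j)) x y := by
  have hR := fun x => Matrix.sum_row_of_mem_rowStochastic hP x
  have h1 : ∀ v, pathExp P n y (fun Y => if v = Y j then 1 else 0) = (P ^ j) y v := fun v => by
    rw [pathExp_eval hR hj y (fun w => if v = w then 1 else 0)]
    simp
  simp only [pairExp, h1]
  rw [pathExp_eval hR hi x (fun w => (P ^ j) y w), pow_add, Matrix.mul_apply]
  exact Finset.sum_congr rfl fun z _ => by rw [pow_apply_comm hS j]

lemma pairExp_interCount (hP : P ∈ Matrix.rowStochastic ℝ V) (hS : P.IsSymm) {n t : ℕ}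
    (ht : t ≤ n) (x y : V) :
    pairExp P n x y (interCount t)
      = ∑ i ∈ Finset.range (t + 1), ∑ j ∈ Finset.range (t + 1), (P ^ (i + j)) x y := by
  have h : (interCount t : (ℕ → V) → (ℕ → V) → ℝ) = fun X Y =>
    ∑ i ∈ Finset.range (t + 1), ∑ j ∈ Finset.range (t + 1), if X i = Y j then 1 else 0 := rfl
  rw [h]
  simp only [pairExp_sum]
  refine Finset.sum_congr rfl fun i hi => Finset.sum_congr rfl fun j hj => ?_
  simp only [Finset.mem_range] at hi hj
  exact pairExp_eval_eq hP hS (by omega) (by omega) x y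

lemma sum_pairExp_interCount (hP : P ∈ Matrix.rowStochastic ℝ V) (hS : P.IsSymm) (t : ℕ) :
    ∑ x, ∑ y, pairExp P t x y (interCount t) = Fintype.card V * ((t : ℝ) + 1) ^ 2 := by
  simp_rw [pairExp_interCount hP hS le_rfl]
  have h : ∀ x, ∑ y, ∑ i ∈ Finset.range (t + 1), ∑ j ∈ Finset.range (t + 1), (P ^ (i + j)) x y
      = ((t : ℝ) + 1) ^ 2 := by
    intro x
    rw [Finset.sum_comm]
    simp_rw [Finset.sum_comm (s := Finset.univ), sum_row_pow hP]
    simp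
    ring
  simp [h]

/-- Started from the (unnormalised) uniform distribution, the positions at times `i` and `k` are
distributed like those of a stationary chain at times `0` and `|i - k|`, written
`(i - k) + (k - i)` with truncated subtraction. -/
lemma sum_pathExp_eval_eval (hP : P ∈ Matrix.rowStochastic ℝ V) (hS : P.IsSymm) {n i k : ℕ}
    (hi : i ≤ n) (hk : k ≤ n) (f : V → V → ℝ) :
    ∑ x, pathExp P n x (fun ω => f (ω i) (ω k))
      = ∑ z, ∑ w, (P ^ ((i - k) + (k - i))) z w * f z w := by
  have hR := fun x => Matrix.sum_row_of_mem_rowStochastic hP x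
  have key : ∀ (i d : ℕ) (f : V → V → ℝ), i + d ≤ n →
      ∑ x, pathExp P n x (fun ω => f (ω i) (ω (i + d))) = ∑ z, ∑ w, (P ^ d) z w * f z w := by
    intro i d f h
    simp_rw [pathExp_eval_eval hR h]
    rw [Finset.sum_comm]
    simp_rw [← Finset.sum_mul, sum_col_pow hP hS, one_mul]
  rcases le_total i k with h | h
  · obtain ⟨d, rfl⟩ := Nat.exists_eq_add_of_le h
    rw [key i d f hk]
    simp
  · obtain ⟨d, rfl⟩ := Nat.exists_eq_add_of_le h
    rw [key k d (fun a b => f b a) hi, Finset.sum_comm]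
    simp_rw [pow_apply_comm hS d]
    simp

lemma sum_range_sum_range_dist_le {g : ℕ → ℝ} (hg : ∀ a, 0 ≤ g a) (M : ℕ) :
    ∑ i ∈ Finset.range M, ∑ k ∈ Finset.range M, g ((i - k) + (k - i))
      ≤ 2 * M * ∑ a ∈ Finset.range M, g a := by
  have h : ∀ i ∈ Finset.range M, ∑ k ∈ Finset.range M, g ((i - k) + (k - i))
      ≤ 2 * ∑ a ∈ Finset.range M, g a := by
    intro i hi
    have h1 : ∀ k ∈ Finset.range M, g ((i - k) + (k - i)) ≤
        ∑ a ∈ Finset.range M, ((if k = i + a then g a else 0) + if i = k + a then g a else 0) := by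
      intro k hk
      simp only [Finset.mem_range] at hi hk
      have hmem : (i - k) + (k - i) ∈ Finset.range M := Finset.mem_range.2 (by omega)
      refine le_trans ?_ (Finset.single_le_sum (f := fun a => (if k = i + a then g a else 0)
        + if i = k + a then g a else 0) (fun a _ => ?_) hmem)
      · rcases le_total i k with h | h
        · have : k = i + ((i - k) + (k - i)) := by omega
          simp only [if_pos this]
          have : (0 : ℝ) ≤ if i = k + ((i - k) + (k - i)) then g ((i - k) + (k - i)) else 0 := by
            split_ifs <;> simp [hg]
          linarith
        · have : i = k + ((i - k) + (k - i)) := by omega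
          simp only [if_pos this]
          have : (0 : ℝ) ≤ if k = i + ((i - k) + (k - i)) then g ((i - k) + (k - i)) else 0 := by
            split_ifs <;> simp [hg]
          linarith
      · have := hg a
        positivity
    refine (Finset.sum_le_sum h1).trans ?_
    rw [Finset.sum_comm, Finset.mul_sum]
    refine Finset.sum_le_sum fun a _ => ?_
    rw [Finset.sum_add_distrib, two_mul]
    refine add_le_add ?_ ?_
    · rw [Finset.sum_ite_eq']
      split_ifs <;> simp [hg]
    · rcases le_or_gt a i with ha | ha
      · have : ∀ k, (if i = k + a then g a else 0) = if k = i - a then g a else 0 := fun k => by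
          congr 1
          exact propext ⟨fun h => by omega, fun h => by omega⟩
        simp_rw [this]
        rw [Finset.sum_ite_eq']
        split_ifs <;> simp [hg]
      · rw [Finset.sum_eq_zero fun k _ => if_neg (by omega)]
        exact hg a
  refine (Finset.sum_le_sum h).trans ?_
  rw [Finset.sum_const, Finset.card_range, nsmul_eq_mul]
  exact le_of_eq (by ring)

lemma sum_pairExp_eval_eq_and_eval_eq (hP : P ∈ Matrix.rowStochastic ℝ V) (hS : P.IsSymm)
    {n i j k l : ℕ} (hi : i ≤ n) (hj : j ≤ n) (hk : k ≤ n) (hl : l ≤ n) :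
    ∑ x, ∑ y, pairExp P n x y
        (fun X Y => (if X i = Y j then 1 else 0) * if X k = Y l then 1 else 0)
      = (P ^ (((i - k) + (k - i)) + ((j - l) + (l - j)))).trace := by
  have h1 : ∀ u v, ∑ y, pathExp P n y (fun Y => (if u = Y j then 1 else 0)
      * if v = Y l then (1 : ℝ) else 0) = (P ^ ((j - l) + (l - j))) u v := fun u v => by
    rw [sum_pathExp_eval_eval hP hS hj hl
      (fun a b => (if u = a then 1 else 0) * if v = b then 1 else 0)]
    simp
  simp only [pairExp, ← pathExp_sum, h1]
  rw [sum_pathExp_eval_eval hP hS hi hk (fun u v => (P ^ ((j - l) + (l - j))) u v)]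
  generalize (i - k) + (k - i) = a
  generalize (j - l) + (l - j) = b
  rw [pow_add, Matrix.trace]
  simp only [Matrix.diag_apply, Matrix.mul_apply]
  exact Finset.sum_congr rfl fun z _ => Finset.sum_congr rfl fun w _ => by
    rw [pow_apply_comm hS b]

lemma trace_pow_nonneg (hP : P ∈ Matrix.rowStochastic ℝ V) (k : ℕ) : 0 ≤ (P ^ k).trace :=
  Finset.sum_nonneg fun x _ => (pow_mem hP k).1 x x

lemma sum_pairExp_interCount_sq_le (hP : P ∈ Matrix.rowStochastic ℝ V) (hS : P.IsSymm) (t : ℕ) :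
    ∑ x, ∑ y, pairExp P t x y (fun X Y => interCount t X Y ^ 2)
      ≤ 4 * ((t : ℝ) + 1) ^ 2 * traceSum P t := by
  have h : ∀ X Y : ℕ → V, interCount t X Y ^ 2 = ∑ i ∈ Finset.range (t + 1),
      ∑ k ∈ Finset.range (t + 1), ∑ j ∈ Finset.range (t + 1), ∑ l ∈ Finset.range (t + 1),
      (if X i = Y j then 1 else 0) * if X k = Y l then 1 else 0 := by
    intro X Y
    rw [sq, interCount, Finset.sum_mul_sum]
    refine Finset.sum_congr rfl fun i _ => Finset.sum_congr rfl fun k _ => ?_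
    rw [Finset.sum_mul_sum]
  have comm : ∀ f : V → V → ℕ → ℝ, ∑ x, ∑ y, ∑ i ∈ Finset.range (t + 1), f x y i
      = ∑ i ∈ Finset.range (t + 1), ∑ x, ∑ y, f x y i := fun f => by
    rw [Finset.sum_comm]
    simp_rw [Finset.sum_comm (s := Finset.univ) (t := Finset.range (t + 1))]
    exact Finset.sum_congr rfl fun i _ => Finset.sum_comm
  simp only [h, pairExp_sum, comm]
  have hM : ((t + 1 : ℕ) : ℝ) = (t : ℝ) + 1 := by push_cast; ring
  calc _ = ∑ i ∈ Finset.range (t + 1), ∑ k ∈ Finset.range (t + 1), ∑ j ∈ Finset.range (t + 1),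
        ∑ l ∈ Finset.range (t + 1), (P ^ (((i - k) + (k - i)) + ((j - l) + (l - j)))).trace := by
        refine Finset.sum_congr rfl fun i hi => Finset.sum_congr rfl fun k hk =>
          Finset.sum_congr rfl fun j hj => Finset.sum_congr rfl fun l hl => ?_
        simp only [Finset.mem_range] at hi hj hk hl
        exact sum_pairExp_eval_eq_and_eval_eq hP hS (by omega) (by omega) (by omega) (by omega)
    _ ≤ ∑ i ∈ Finset.range (t + 1), ∑ k ∈ Finset.range (t + 1), 2 * ((t : ℝ) + 1)
        * ∑ b ∈ Finset.range (t + 1), (P ^ (((i - k) + (k - i)) + b)).trace := by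
        refine Finset.sum_le_sum fun i _ => Finset.sum_le_sum fun k _ => ?_
        rw [← hM]
        exact sum_range_sum_range_dist_le
          (g := fun b => (P ^ (((i - k) + (k - i)) + b)).trace)
          (fun b => trace_pow_nonneg hP _) (t + 1)
    _ ≤ 2 * ((t : ℝ) + 1) * ∑ a ∈ Finset.range (t + 1), (2 * ((t : ℝ) + 1)
        * ∑ b ∈ Finset.range (t + 1), (P ^ (a + b)).trace) := by
        rw [← hM]
        refine sum_range_sum_range_dist_le (g := fun a => 2 * ((t + 1 : ℕ) : ℝ)
          * ∑ b ∈ Finset.range (t + 1), (P ^ (a + b)).trace) (fun a => ?_) (t + 1)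
        exact mul_nonneg (by positivity) (Finset.sum_nonneg fun b _ => trace_pow_nonneg hP _)
    _ = _ := by
        rw [← Finset.mul_sum, traceSum]
        ring

end Moments

/-! ### Probability that two chains have met -/

section Meeting

variable {V : Type*}

/-- The trajectories have intersected by time `t`, that is `{X_0, …, X_t} ∩ {Y_0, …, Y_t} ≠ ∅`. -/
def Meets (t : ℕ) (X Y : ℕ → V) : Prop := ∃ i ≤ t, ∃ j ≤ t, X i = Y j

open Classical in
/-- The indicator that the trajectories have not intersected by time `t`. -/
noncomputable def missInd (t : ℕ) (X Y : ℕ → V) : ℝ := if Meets t X Y then 0 else 1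

open Classical in
/-- The indicator that the trajectories have intersected by time `t`. -/
noncomputable def meetInd (t : ℕ) (X Y : ℕ → V) : ℝ := if Meets t X Y then 1 else 0

lemma missInd_nonneg (t : ℕ) (X Y : ℕ → V) : 0 ≤ missInd t X Y := by
  unfold missInd; split_ifs <;> norm_num

lemma missInd_le_one (t : ℕ) (X Y : ℕ → V) : missInd t X Y ≤ 1 := by
  unfold missInd; split_ifs <;> norm_num

lemma meetInd_add_missInd (t : ℕ) (X Y : ℕ → V) : meetInd t X Y + missInd t X Y = 1 := by
  unfold missInd meetInd; split_ifs <;> norm_num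

lemma meetInd_of_meets {t : ℕ} {X Y : ℕ → V} (h : Meets t X Y) : meetInd t X Y = 1 := by
  simp [meetInd, h]

lemma missInd_of_meets {t : ℕ} {X Y : ℕ → V} (h : Meets t X Y) : missInd t X Y = 0 := by
  simp [missInd, h]

lemma meetInd_nonneg (t : ℕ) (X Y : ℕ → V) : 0 ≤ meetInd t X Y := by
  unfold meetInd; split_ifs <;> norm_num

lemma Meets.congr {t : ℕ} {X Y X' Y' : ℕ → V} (hX : ∀ k ≤ t, X k = X' k)
    (hY : ∀ k ≤ t, Y k = Y' k) : Meets t X Y ↔ Meets t X' Y' :=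
  exists_congr fun i => and_congr_right fun hi => exists_congr fun j => and_congr_right fun hj => by
    rw [hX i hi, hY j hj]

lemma meetInd_dependsOn_left (t : ℕ) (Y : ℕ → V) :
    DependsOn (fun X => meetInd t X Y) (Set.Iic t) := fun X X' h => by
  have hM : Meets t X Y ↔ Meets t X' Y := Meets.congr (fun k hk => h k hk) fun _ _ => rfl
  classical exact if_congr hM rfl rfl

lemma meetInd_dependsOn_right (t : ℕ) (X : ℕ → V) :
    DependsOn (fun Y => meetInd t X Y) (Set.Iic t) := fun Y Y' h => by
  have hM : Meets t X Y ↔ Meets t X Y' := Meets.congr (fun _ _ => rfl) fun k hk => h k hk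
  classical exact if_congr hM rfl rfl

lemma missInd_eq (t : ℕ) (X Y : ℕ → V) : missInd t X Y = 1 - meetInd t X Y :=
  eq_sub_of_add_eq' (meetInd_add_missInd t X Y)

lemma missInd_dependsOn_left (t : ℕ) (Y : ℕ → V) :
    DependsOn (fun X => missInd t X Y) (Set.Iic t) := fun X X' h => by
  simp only [missInd_eq]
  exact congrArg (1 - ·) (meetInd_dependsOn_left t Y h)

lemma missInd_dependsOn_right (t : ℕ) (X : ℕ → V) :
    DependsOn (missInd t X) (Set.Iic t) := fun Y Y' h => by
  simp only [missInd_eq]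
  exact congrArg (1 - ·) (meetInd_dependsOn_right t X h)

lemma interCount_dependsOn_left [DecidableEq V] (t : ℕ) (Y : ℕ → V) :
    DependsOn (fun X => interCount t X Y) (Set.Iic t) := fun X X' h => by
  refine Finset.sum_congr rfl fun i hi => Finset.sum_congr rfl fun j _ => ?_
  rw [h i (Finset.mem_range_succ_iff.1 hi)]

lemma interCount_dependsOn_right [DecidableEq V] (t : ℕ) (X : ℕ → V) :
    DependsOn (fun Y => interCount t X Y) (Set.Iic t) := fun Y Y' h => by
  refine Finset.sum_congr rfl fun i _ => Finset.sum_congr rfl fun j hj => ?_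
  rw [h j (Finset.mem_range_succ_iff.1 hj)]

lemma interCount_eq_mul_meetInd [DecidableEq V] (t : ℕ) (X Y : ℕ → V) :
    interCount t X Y = interCount t X Y * meetInd t X Y := by
  by_cases h : Meets t X Y
  · rw [meetInd_of_meets h, mul_one]
  · have : interCount t X Y = 0 := by
      refine Finset.sum_eq_zero fun i hi => Finset.sum_eq_zero fun j hj => if_neg fun hij => h ?_
      exact ⟨i, Finset.mem_range_succ_iff.1 hi, j, Finset.mem_range_succ_iff.1 hj, hij⟩
    rw [this, zero_mul]

lemma sum_range_add_le_sum_range {f : ℕ → ℝ} (hf : ∀ a, 0 ≤ f a) {i m M : ℕ} (h : i + m ≤ M) :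
    ∑ a ∈ Finset.range m, f (i + a) ≤ ∑ a ∈ Finset.range M, f a := by
  have := Finset.sum_Ico_eq_sum_range f i (i + m)
  rw [Nat.add_sub_cancel_left] at this
  rw [← this, Finset.range_eq_Ico]
  exact Finset.sum_le_sum_of_subset_of_nonneg (Finset.Ico_subset_Ico (Nat.zero_le _) h)
    fun a _ _ => hf a

lemma interCount_le_interCount_splice [DecidableEq V] {i j t : ℕ} (hi : i ≤ t) (hj : j ≤ t)
    (X Y X' Y' : ℕ → V) :
    interCount t X' Y' ≤ interCount (t + t) (splice i X X') (splice j Y Y') := by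
  have h1 : ∑ a ∈ Finset.range (t + 1), ∑ b ∈ Finset.range (t + t + 1),
      (if splice i X X' (i + a) = splice j Y Y' b then (1 : ℝ) else 0)
        ≤ interCount (t + t) (splice i X X') (splice j Y Y') :=
    sum_range_add_le_sum_range (f := fun a => ∑ b ∈ Finset.range (t + t + 1),
      if splice i X X' a = splice j Y Y' b then (1 : ℝ) else 0)
      (fun a => Finset.sum_nonneg fun b _ => by positivity) (by omega)
  refine le_trans (Finset.sum_le_sum fun a _ => ?_) h1
  have h2 := sum_range_add_le_sum_range (i := j) (m := t + 1) (M := t + t + 1)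
      (f := fun b => if X' a = splice j Y Y' b then (1 : ℝ) else 0) (fun b => by positivity)
      (by omega)
  simpa using h2

lemma missInd_splice_le {N T : ℕ} {X Y X' Y' : ℕ → V} (hX : X' 0 = X N) (hY : Y' 0 = Y N) :
    missInd (N + T) (splice N X X') (splice N Y Y') ≤ missInd N X Y * missInd T X' Y' := by
  by_cases h1 : Meets N X Y
  · rw [missInd_of_meets h1, zero_mul, missInd_of_meets]
    obtain ⟨i, hi, j, hj, hij⟩ := h1
    exact ⟨i, by omega, j, by omega, by rwa [splice_of_le hX hi, splice_of_le hY hj]⟩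
  by_cases h2 : Meets T X' Y'
  · rw [missInd_of_meets h2, mul_zero, missInd_of_meets]
    obtain ⟨i, hi, j, hj, hij⟩ := h2
    exact ⟨N + i, by omega, N + j, by omega, by simpa using hij⟩
  · simpa [missInd, h1, h2] using missInd_le_one (N + T) (splice N X X') (splice N Y Y')

variable [Fintype V]

lemma pairExp_add (P : Matrix V V ℝ) (n : ℕ) (x y : V) (F G : (ℕ → V) → (ℕ → V) → ℝ) :
    pairExp P n x y (fun X Y => F X Y + G X Y) = pairExp P n x y F + pairExp P n x y G := by
  simp only [pairExp, pathExp_add]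

lemma pairExp_const_mul (P : Matrix V V ℝ) (n : ℕ) (x y : V) (c : ℝ)
    (F : (ℕ → V) → (ℕ → V) → ℝ) :
    pairExp P n x y (fun X Y => c * F X Y) = c * pairExp P n x y F := by
  simp only [pairExp, pathExp_const_mul]

variable [DecidableEq V] {P : Matrix V V ℝ}

/-- The probability that chains started from `x` and `y` have intersected by time `t`. -/
noncomputable def meetProb (P : Matrix V V ℝ) (t : ℕ) (x y : V) : ℝ := pairExp P t x y (meetInd t)

/-- The probability that chains started from `x` and `y` have not intersected by time `t`. -/
noncomputable def missProb (P : Matrix V V ℝ) (t : ℕ) (x y : V) : ℝ := pairExp P t x y (missInd t)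

lemma pairExp_const (hP : P ∈ Matrix.rowStochastic ℝ V) (n : ℕ) (x y : V) (c : ℝ) :
    pairExp P n x y (fun _ _ => c) = c := by
  have hR := fun x => Matrix.sum_row_of_mem_rowStochastic hP x
  simp only [pairExp, pathExp_const hR]

lemma pairExp_nonneg (hP : P ∈ Matrix.rowStochastic ℝ V) (n : ℕ) (x y : V)
    {F : (ℕ → V) → (ℕ → V) → ℝ} (h : ∀ X Y, 0 ≤ F X Y) : 0 ≤ pairExp P n x y F :=
  pathExp_nonneg hP.1 n x fun X => pathExp_nonneg hP.1 n y fun Y => h X Y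

lemma meetProb_add_missProb (hP : P ∈ Matrix.rowStochastic ℝ V) (t : ℕ) (x y : V) :
    meetProb P t x y + missProb P t x y = 1 := by
  rw [meetProb, missProb, ← pairExp_add]
  simp only [meetInd_add_missInd]
  exact pairExp_const hP t x y 1

lemma missProb_nonneg (hP : P ∈ Matrix.rowStochastic ℝ V) (t : ℕ) (x y : V) :
    0 ≤ missProb P t x y := pairExp_nonneg hP t x y fun X Y => missInd_nonneg t X Y

lemma meetProb_nonneg (hP : P ∈ Matrix.rowStochastic ℝ V) (t : ℕ) (x y : V) :
    0 ≤ meetProb P t x y := pairExp_nonneg hP t x y fun X Y => meetInd_nonneg t X Y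

lemma missProb_le_one (hP : P ∈ Matrix.rowStochastic ℝ V) (t : ℕ) (x y : V) :
    missProb P t x y ≤ 1 := by
  linarith [meetProb_add_missProb hP t x y, meetProb_nonneg hP t x y]

/-- Second moment bound: under the uniform initial distribution
`P(I > 0) ≥ (E I)² / E[I²] ≥ (t+1)² / (4 ∑_{i, j ≤ t} tr P^(i+j))`. -/
lemma card_sq_mul_le_sum_meetProb (hP : P ∈ Matrix.rowStochastic ℝ V) (hS : P.IsSymm) [Nonempty V]
    (t : ℕ) : (Fintype.card V : ℝ) ^ 2 * ((t : ℝ) + 1) ^ 2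
      ≤ 4 * traceSum P t * ∑ x, ∑ y, meetProb P t x y := by
  set a : ℝ := Fintype.card V * ((t : ℝ) + 1) ^ 2 with ha
  set p := ∑ x, ∑ y, meetProb P t x y with hp
  set b := ∑ x, ∑ y, pairExp P t x y (fun X Y => interCount t X Y ^ 2) with hb
  have hV : (0 : ℝ) < Fintype.card V := by exact_mod_cast Fintype.card_pos
  have ha0 : 0 < a := by positivity
  -- the discriminant form of the Cauchy-Schwarz inequality
  have key : ∀ c : ℝ, 2 * c * a ≤ c ^ 2 * p + b := by
    intro c
    rw [ha, ← sum_pairExp_interCount hP hS, hp, hb]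
    simp only [Finset.mul_sum, ← Finset.sum_add_distrib, meetProb, ← pairExp_const_mul,
      ← pairExp_add]
    refine Finset.sum_le_sum fun x _ => Finset.sum_le_sum fun y _ =>
      pairExp_mono hP.1 t x y fun X Y _ _ => ?_
    rw [interCount_eq_mul_meetInd]
    unfold meetInd
    split_ifs
    · nlinarith [sq_nonneg (c - interCount t X Y)]
    · nlinarith
  have hp0 : 0 ≤ p := Finset.sum_nonneg fun x _ => Finset.sum_nonneg fun y _ =>
    meetProb_nonneg hP t x y
  have hbH := sum_pairExp_interCount_sq_le hP hS t
  rw [← hb] at hbH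
  have hb0 : 0 ≤ b := by nlinarith [key 0]
  have hab : a ^ 2 ≤ p * b := by
    rcases hp0.eq_or_lt with h0 | h0
    · have := key ((b + 1) / a)
      rw [← h0] at this ⊢
      have h2 : 2 * ((b + 1) / a) * a = 2 * (b + 1) := by field_simp
      linarith
    · have := key (a / p)
      have h2 : 2 * (a / p) * a = 2 * (a ^ 2 / p) := by ring
      have h3 : (a / p) ^ 2 * p = a ^ 2 / p := by field_simp
      rw [h2, h3] at this
      have h4 : a ^ 2 / p ≤ b := by linarith
      rw [div_le_iff₀ h0] at h4
      linarith
  have h1 : a ^ 2 ≤ p * (4 * ((t : ℝ) + 1) ^ 2 * traceSum P t) :=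
    hab.trans (mul_le_mul_of_nonneg_left hbH hp0)
  have ht : (0 : ℝ) < ((t : ℝ) + 1) ^ 2 := by positivity
  rw [ha] at h1
  refine le_of_mul_le_mul_right ?_ ht
  linarith

/-- Under the uniform initial distribution `P(I > 0) (∑_{i,j ≤ t} p_{i+j}(x,x))²` is at most a
constant times the second moment of the number of intersections up to time `2t`. -/
lemma sum_meetProb_mul_le (hP : P ∈ Matrix.rowStochastic ℝ V) (hS : P.IsSymm)
    (hD : ∀ (k : ℕ) (z : V), Fintype.card V * (P ^ k) z z = (P ^ k).trace) (t : ℕ) :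
    (∑ x, ∑ y, meetProb P t x y) * traceSum P t ^ 2
      ≤ 64 * (Fintype.card V : ℝ) ^ 2 * (2 * t + 1) ^ 2 * traceSum P (t + t) := by
  classical
  rcases isEmpty_or_nonempty V with hV | hV
  · simp
  have hR := fun x => Matrix.sum_row_of_mem_rowStochastic hP x
  have hV0 : (0 : ℝ) < Fintype.card V := by exact_mod_cast Fintype.card_pos
  set g := traceSum P t / Fintype.card V with hg
  have hgz : ∀ z, ∑ i ∈ Finset.range (t + 1), ∑ j ∈ Finset.range (t + 1), (P ^ (i + j)) z z = g := by
    intro z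
    rw [hg, eq_div_iff hV0.ne', traceSum, mul_comm]
    simp only [Finset.mul_sum, hD]
  have hg0 : 0 ≤ g := div_nonneg (Finset.sum_nonneg fun i _ => Finset.sum_nonneg fun j _ =>
    trace_pow_nonneg hP _) hV0.le
  have hone : ∀ x y, meetProb P t x y * g ^ 2
      ≤ 16 * pairExp P (t + t) x y (fun X Y => interCount (t + t) X Y ^ 2) := by
    intro x y
    have h1 : meetProb P t x y
        = pairExp P (t + t) x y (fun X Y => if Meets t X Y then 1 else 0) := by
      have : (fun X Y => if Meets t X Y then (1 : ℝ) else 0) = fun X Y : ℕ → V => meetInd t X Y := by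
        ext X Y; simp [meetInd]
      rw [this, pairExp]
      simp only [pathExp_add_of_dependsOn hR t t y (meetInd_dependsOn_right t _)]
      rw [pathExp_add_of_dependsOn hR t t x]
      · rfl
      · intro X X' h
        exact congrArg (pathExp P t y) (funext fun Y => meetInd_dependsOn_left t Y h)
    rw [h1]
    refine pairExp_indicator_mul_sq_le hP (t + t) x y (fun X Y => interCount_nonneg _ X Y) _ hg0 ?_
    rintro X Y ⟨i, hi, j, hj, hij⟩
    refine ⟨i, t + (t - i), j, t + (t - j), by omega, by omega, ?_⟩
    calc g = pairExp P t (X i) (X i) (interCount t) := by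
          rw [pairExp_interCount hP hS le_rfl, hgz]
      _ = pathExp P (t + (t - j)) (X i) (fun Y' =>
            pathExp P (t + (t - i)) (X i) (fun X' => interCount t X' Y')) := by
          simp only [pathExp_add_of_dependsOn hR t (t - i) (X i) (interCount_dependsOn_left t _)]
          rw [pathExp_add_of_dependsOn hR t (t - j), pairExp, pathExp_comm]
          intro Y Y' h
          exact congrArg (pathExp P t (X i))
            (funext fun X' => interCount_dependsOn_right t X' h)
      _ ≤ _ := by
          rw [← hij]
          exact pathExp_mono hP.1 _ _ fun Y' _ => pathExp_mono hP.1 _ _ fun X' _ =>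
            interCount_le_interCount_splice hi hj X Y X' Y'
  have hsum : (∑ x, ∑ y, meetProb P t x y) * g ^ 2
      ≤ 64 * (2 * t + 1) ^ 2 * traceSum P (t + t) := by
    have h2 := sum_pairExp_interCount_sq_le hP hS (t + t)
    push_cast at h2
    calc (∑ x, ∑ y, meetProb P t x y) * g ^ 2
        ≤ 16 * ∑ x, ∑ y, pairExp P (t + t) x y (fun X Y => interCount (t + t) X Y ^ 2) := by
          simp only [Finset.mul_sum, Finset.sum_mul]
          exact Finset.sum_le_sum fun x _ => Finset.sum_le_sum fun y _ => hone x y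
      _ ≤ _ := by linarith
  have hgt : traceSum P t = g * Fintype.card V := by rw [hg]; field_simp
  rw [hgt]
  nlinarith [mul_le_mul_of_nonneg_right hsum (sq_nonneg (Fintype.card V : ℝ))]

/-- The Markov property for the non-intersection probability. -/
lemma missProb_add_le (hP : P ∈ Matrix.rowStochastic ℝ V) (N T : ℕ) (x y : V) :
    missProb P (N + T) x y
      ≤ pairExp P N x y (fun X Y => missInd N X Y * missProb P T (X N) (Y N)) := by
  rw [missProb, pairExp, pathExp_add_eq, pairExp]
  refine pathExp_mono hP.1 N x fun X _ => ?_
  simp_rw [pathExp_add_eq P N T y]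
  rw [pathExp_comm]
  refine pathExp_mono hP.1 N y fun Y _ => ?_
  rw [missProb, ← pairExp_const_mul]
  exact pathExp_mono hP.1 T _ fun X' hX => pathExp_mono hP.1 T _ fun Y' hY =>
    missInd_splice_le hX hY

/-- If from every pair of starting points the chains intersect by time `T` with probability at least
`1 - ρ`, then the expected intersection time is at most `T / (1 - ρ)`. -/
lemma sum_missProb_le (hP : P ∈ Matrix.rowStochastic ℝ V) {T : ℕ} (hT : 0 < T) {ρ : ℝ}
    (hρ : ρ < 1) (h : ∀ x y, missProb P T x y ≤ ρ) (K : ℕ) (x y : V) :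
    ∑ N ∈ Finset.range K, missProb P N x y ≤ T / (1 - ρ) := by
  have h1ρ : 0 < 1 - ρ := by linarith
  have hρ0 : 0 ≤ ρ := (missProb_nonneg hP T x y).trans (h x y)
  have hle : ∀ K x y, ∑ N ∈ Finset.range K, missProb P N x y ≤ K := fun K x y => by
    simpa using Finset.sum_le_sum fun N (_ : N ∈ Finset.range K) => missProb_le_one hP N x y
  have hC : (T : ℝ) ≤ T / (1 - ρ) := by
    rw [le_div_iff₀ h1ρ]
    nlinarith [Nat.cast_nonneg (α := ℝ) T]
  induction K using Nat.strong_induction_on generalizing x y with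
  | _ K ih =>
    rcases le_or_gt K T with hK | hK
    · exact (hle K x y).trans ((Nat.cast_le.2 hK).trans hC)
    obtain ⟨K, rfl⟩ := Nat.exists_eq_add_of_lt hK
    rw [add_assoc, Finset.sum_range_add]
    have h2 : ∑ N ∈ Finset.range (K + 1), missProb P (T + N) x y ≤ T / (1 - ρ) * ρ := by
      calc _ ≤ ∑ N ∈ Finset.range (K + 1),
            pairExp P T x y (fun X Y => missInd T X Y * missProb P N (X T) (Y T)) :=
            Finset.sum_le_sum fun N _ => missProb_add_le hP T N x y
        _ = pairExp P T x y (fun X Y => missInd T X Y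
              * ∑ N ∈ Finset.range (K + 1), missProb P N (X T) (Y T)) := by
            rw [← pairExp_sum]
            simp only [Finset.mul_sum]
        _ ≤ pairExp P T x y (fun X Y => T / (1 - ρ) * missInd T X Y) := by
            refine pairExp_mono hP.1 T x y fun X Y _ _ => ?_
            rw [mul_comm]
            exact mul_le_mul_of_nonneg_right (ih (K + 1) (by omega) _ _) (missInd_nonneg T X Y)
        _ ≤ T / (1 - ρ) * ρ := by
            rw [pairExp_const_mul]
            exact mul_le_mul_of_nonneg_left (h x y) (by positivity)
    have h3 : (T : ℝ) + T / (1 - ρ) * ρ = T / (1 - ρ) := by field_simp; ring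
    linarith [hle T x y]

/-- Only the intersections between times `m` and `m + t` are counted; the positions at time `m`
are distributed according to `P ^ m`. -/
lemma sum_mul_meetProb_le (hP : P ∈ Matrix.rowStochastic ℝ V) (m t : ℕ) (x y : V) :
    ∑ z, ∑ w, (P ^ m) x z * (P ^ m) y w * meetProb P t z w ≤ meetProb P (m + t) x y := by
  have hR := fun x => Matrix.sum_row_of_mem_rowStochastic hP x
  calc _ = pairExp P (m + t) x y
        (fun X Y => meetInd t (fun k => X (m + k)) (fun k => Y (m + k))) := by
        simp only [pairExp]
        simp_rw [fun X' => pathExp_shift hR m t y (fun Y => meetInd t X' Y)]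
        rw [pathExp_shift hR m t x (fun X' => ∑ z, (P ^ m) y z * pathExp P t z
          (fun Y => meetInd t X' Y))]
        refine Finset.sum_congr rfl fun z _ => ?_
        rw [pathExp_finsetSum, Finset.mul_sum]
        refine Finset.sum_congr rfl fun w _ => ?_
        rw [mul_assoc]
        rfl
    _ ≤ _ := by
        refine pairExp_mono hP.1 _ x y fun X Y _ _ => ?_
        by_cases h : Meets t (fun k => X (m + k)) (fun k => Y (m + k))
        · rw [meetInd_of_meets h, meetInd_of_meets]
          obtain ⟨i, hi, j, hj, hij⟩ := h
          exact ⟨m + i, by omega, m + j, by omega, hij⟩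
        · simp only [meetInd, h, if_false]
          exact meetInd_nonneg _ _ _

open Classical in
/-- A chain started near the maximum `1` of an eigenfunction takes time of the order of the
relaxation time to come down to level `1/2`. -/
lemma pathExp_exists_le_half_le (hP : P ∈ Matrix.rowStochastic ℝ V) {l : ℝ} (hl0 : 0 ≤ l)
    (hl1 : l ≤ 1) {f : V → ℝ} (hf : ∀ x, ∑ y, P x y * f y = l * f x) (hf1 : ∀ x, f x ≤ 1)
    (n : ℕ) (x : V) :
    pathExp P n x (fun ω => if ∃ i ≤ n, f (ω i) ≤ 1 / 2 then 1 else 0)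
      ≤ 2 * (1 - l ^ n * f x) := by
  have hR := fun x => Matrix.sum_row_of_mem_rowStochastic hP x
  have hlow : ∀ n x, f x ≤ 1 / 2 →
      pathExp P n x (fun ω => if ∃ i ≤ n, f (ω i) ≤ 1 / 2 then 1 else 0)
        ≤ 2 * (1 - l ^ n * f x) := by
    intro n x hx
    have h1 : pathExp P n x (fun ω => if ∃ i ≤ n, f (ω i) ≤ 1 / 2 then 1 else 0) ≤ 1 := by
      refine (pathExp_mono hP.1 n x fun ω _ => ?_).trans_eq (pathExp_const hR n x 1)
      split_ifs <;> norm_num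
    have h2 : l ^ n ≤ 1 := pow_le_one₀ hl0 hl1
    have h3 : 0 ≤ l ^ n := pow_nonneg hl0 n
    nlinarith
  induction n generalizing x with
  | zero =>
    rcases le_or_gt (f x) (1 / 2) with hx | hx
    · exact hlow 0 x hx
    · simp only [pathExp, nonpos_iff_eq_zero, exists_eq_left, pow_zero, one_mul, if_neg hx.not_ge]
      linarith [hf1 x]
  | succ n ih =>
    rcases le_or_gt (f x) (1 / 2) with hx | hx
    · exact hlow (n + 1) x hx
    have hev : ∀ ω : ℕ → V, (∃ i ≤ n + 1, f (consPath x ω i) ≤ 1 / 2)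
        ↔ ∃ i ≤ n, f (ω i) ≤ 1 / 2 := by
      refine fun ω => ⟨?_, fun ⟨i, hi, h⟩ => ⟨i + 1, by omega, h⟩⟩
      rintro ⟨i, hi, h⟩
      cases i with
      | zero => exact absurd h hx.not_ge
      | succ i => exact ⟨i, by omega, h⟩
    simp only [pathExp, hev]
    calc _ ≤ ∑ y, P x y * (2 * (1 - l ^ n * f y)) :=
          Finset.sum_le_sum fun y _ => mul_le_mul_of_nonneg_left (ih y) (hP.1 x y)
      _ = 2 * (∑ y, P x y - l ^ n * ∑ y, P x y * f y) := by
          rw [Finset.mul_sum, ← Finset.sum_sub_distrib, Finset.mul_sum]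
          exact Finset.sum_congr rfl fun y _ => by ring
      _ = _ := by rw [hR, hf]; ring

open Classical in
/-- A chain started near the minimum of an eigenfunction takes time of the order of the relaxation
time to rise to a given positive level. -/
lemma pathExp_exists_half_le_mul_le (hP : P ∈ Matrix.rowStochastic ℝ V) {l : ℝ} (hl0 : 0 ≤ l)
    (hl1 : l ≤ 1) {f : V → ℝ} (hf : ∀ x, ∑ y, P x y * f y = l * f x) {m : ℝ} (hm : 0 ≤ m)
    (hfm : ∀ x, -m ≤ f x) {N n : ℕ} (hn : n ≤ N) (x : V) :
    pathExp P n x (fun ω => if ∃ i ≤ n, 1 / 2 ≤ f (ω i) then 1 else 0) * (l ^ N / 2 + m)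
      ≤ l ^ n * f x + m := by
  have hR := fun x => Matrix.sum_row_of_mem_rowStochastic hP x
  have hN : 0 ≤ l ^ N := pow_nonneg hl0 N
  have hhigh : ∀ n ≤ N, ∀ x, 1 / 2 ≤ f x →
      pathExp P n x (fun ω => if ∃ i ≤ n, 1 / 2 ≤ f (ω i) then 1 else 0) * (l ^ N / 2 + m)
        ≤ l ^ n * f x + m := by
    intro n hn x hx
    have h1 : pathExp P n x (fun ω => if ∃ i ≤ n, 1 / 2 ≤ f (ω i) then 1 else 0) ≤ 1 := by
      refine (pathExp_mono hP.1 n x fun ω _ => ?_).trans_eq (pathExp_const hR n x 1)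
      split_ifs <;> norm_num
    have h2 : l ^ N ≤ l ^ n := pow_le_pow_of_le_one hl0 hl1 hn
    nlinarith [mul_le_mul_of_nonneg_right h1 (show 0 ≤ l ^ N / 2 + m by positivity)]
  induction n generalizing x with
  | zero =>
    rcases le_or_gt (1 / 2) (f x) with hx | hx
    · exact hhigh 0 hn x hx
    · simp only [pathExp, nonpos_iff_eq_zero, exists_eq_left, if_neg hx.not_ge]
      linarith [hfm x]
  | succ n ih =>
    rcases le_or_gt (1 / 2) (f x) with hx | hx
    · exact hhigh (n + 1) hn x hx
    have hev : ∀ ω : ℕ → V, (∃ i ≤ n + 1, 1 / 2 ≤ f (consPath x ω i))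
        ↔ ∃ i ≤ n, 1 / 2 ≤ f (ω i) := by
      refine fun ω => ⟨?_, fun ⟨i, hi, h⟩ => ⟨i + 1, by omega, h⟩⟩
      rintro ⟨i, hi, h⟩
      cases i with
      | zero => exact absurd h hx.not_ge
      | succ i => exact ⟨i, by omega, h⟩
    simp only [pathExp, hev]
    rw [Finset.sum_mul]
    calc _ ≤ ∑ y, P x y * (l ^ n * f y + m) :=
          Finset.sum_le_sum fun y _ => by
            rw [mul_assoc]
            exact mul_le_mul_of_nonneg_left (ih (by omega) y) (hP.1 x y)
      _ = l ^ n * (∑ y, P x y * f y) + m * ∑ y, P x y := by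
          rw [Finset.mul_sum, Finset.mul_sum, ← Finset.sum_add_distrib]
          exact Finset.sum_congr rfl fun y _ => by ring
      _ = _ := by rw [hR, hf]; ring

/-- Chains started from a maximum and from a minimum of an eigenfunction need time of the order of
the corresponding relaxation time to intersect. -/
lemma meetProb_le_of_eigenfunction (hP : P ∈ Matrix.rowStochastic ℝ V) {l : ℝ} (hl0 : 0 ≤ l)
    (hl1 : l ≤ 1) {f : V → ℝ} (hf : ∀ x, ∑ y, P x y * f y = l * f x) (hf1 : ∀ x, f x ≤ 1)
    {x y : V} (hx : f x = 1) (hy : ∀ z, f y ≤ f z) (hy0 : f y < 0) (t : ℕ) :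
    meetProb P t x y ≤ 3 * (1 - l ^ t) := by
  classical
  have hR := fun x => Matrix.sum_row_of_mem_rowStochastic hP x
  set A : (ℕ → V) → ℝ := fun ω => if ∃ i ≤ t, f (ω i) ≤ 1 / 2 then 1 else 0 with hA
  set B : (ℕ → V) → ℝ := fun ω => if ∃ i ≤ t, 1 / 2 ≤ f (ω i) then 1 else 0 with hB
  have h1 : pathExp P t x A ≤ 2 * (1 - l ^ t) := by
    have := pathExp_exists_le_half_le hP hl0 hl1 hf hf1 t x
    rw [hx, mul_one] at this
    convert! this
  have h2 : pathExp P t y B ≤ 1 - l ^ t := by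
    have := pathExp_exists_half_le_mul_le hP hl0 hl1 hf (m := -f y) (by linarith)
      (fun z => by linarith [hy z]) (le_refl t) y
    have hB0 : 0 ≤ pathExp P t y B := pathExp_nonneg hP.1 t y fun ω => by
      simp only [hB]; split_ifs <;> norm_num
    have h3 : pathExp P t y B * (l ^ t / 2 + -f y) ≤ l ^ t * f y + -f y := by convert! this
    have h4 : 0 ≤ pathExp P t y B * (l ^ t / 2) := by positivity
    refine le_of_mul_le_mul_right ?_ (neg_pos.2 hy0)
    nlinarith
  have h3 : meetProb P t x y ≤ pairExp P t x y (fun X Y => A X + B Y) := by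
    refine pairExp_mono hP.1 t x y fun X Y _ _ => ?_
    have hA0 : 0 ≤ A X := by simp only [hA]; split_ifs <;> norm_num
    have hB0 : 0 ≤ B Y := by simp only [hB]; split_ifs <;> norm_num
    by_cases h : Meets t X Y
    · rw [meetInd_of_meets h]
      obtain ⟨i, hi, j, hj, hij⟩ := h
      rcases le_total (f (X i)) (1 / 2) with h | h
      · have : A X = 1 := if_pos ⟨i, hi, h⟩
        linarith
      · have : B Y = 1 := if_pos ⟨j, hj, hij ▸ h⟩
        linarith
    · simp only [meetInd, h, if_false]
      linarith
  have h4 : pairExp P t x y (fun X Y => A X + B Y) = pathExp P t x A + pathExp P t y B := by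
    simp only [pairExp, pathExp_add, pathExp_const hR]
  linarith

end Meeting

/-! ### Transitivity, irreducibility and the spectrum -/

section Spectrum

variable {V : Type*} [Fintype V] [DecidableEq V]

/-- Maximum principle. -/
lemma eq_of_harmonic {P : Matrix V V ℝ} (hP : P ∈ Matrix.rowStochastic ℝ V)
    (hI : P.IsIrreducible) {f : V → ℝ} (hf : P.mulVec f = f) (x y : V) : f x = f y := by
  have : Nonempty V := ⟨x⟩
  have hpow : ∀ k, (P ^ k).mulVec f = f := fun k => by
    induction k with
    | zero => simp
    | succ k ih => rw [pow_succ, ← Matrix.mulVec_mulVec, hf, ih]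
  obtain ⟨z, hz⟩ := Finite.exists_max f
  have hmax : ∀ w, f w = f z := by
    intro w
    obtain ⟨k, -, hk⟩ := (Matrix.isIrreducible_iff_exists_pow_pos hP.1).1 hI z w
    have h1 : ∑ v, (P ^ k) z v * (f z - f v) = 0 := by
      have h2 : ∑ v, (P ^ k) z v * f v = f z := congrFun (hpow k) z
      simp_rw [mul_sub, Finset.sum_sub_distrib, ← Finset.sum_mul, sum_row_pow hP, h2]
      ring
    have h3 := (Finset.sum_eq_zero_iff_of_nonneg fun v _ =>
      mul_nonneg ((pow_mem hP k).1 z v) (sub_nonneg.2 (hz v))).1 h1 w (Finset.mem_univ w)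
    rcases mul_eq_zero.1 h3 with h | h
    · exact absurd h hk.ne'
    · linarith
  rw [hmax x, hmax y]

lemma pow_apply_equiv {P : Matrix V V ℝ} {φ : V ≃ V} (hφ : ∀ z w, P z w = P (φ z) (φ w)) (k : ℕ)
    (z w : V) : (P ^ k) z w = (P ^ k) (φ z) (φ w) := by
  induction k generalizing z w with
  | zero => simp [Matrix.one_apply]
  | succ k ih =>
    rw [pow_succ, Matrix.mul_apply, Matrix.mul_apply,
      ← Equiv.sum_comp φ (fun v => (P ^ k) (φ z) v * P v (φ w))]
    exact Finset.sum_congr rfl fun v _ => by rw [ih, hφ]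

lemma IsTransitive.card_mul_pow_apply {P : Matrix.rowStochastic ℝ V} (hT : IsTransitive P) (k : ℕ)
    (z : V) : Fintype.card V * (P.1 ^ k) z z = (P.1 ^ k).trace := by
  have h : ∀ w, (P.1 ^ k) w w = (P.1 ^ k) z z := fun w => by
    obtain ⟨φ, hφ, h⟩ := hT w z
    rw [pow_apply_equiv h k w w, hφ]
  simp [Matrix.trace, h]

lemma IsTransitive.sum_col {P : Matrix.rowStochastic ℝ V} (hT : IsTransitive P) (y : V) :
    ∑ x, P.1 x y = 1 := by
  have : Nonempty V := ⟨y⟩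
  have h : ∀ w, ∑ x, P.1 x w = ∑ x, P.1 x y := fun w => by
    obtain ⟨φ, hφ, h⟩ := hT w y
    rw [← Equiv.sum_comp φ (fun x => P.1 x y)]
    exact Finset.sum_congr rfl fun x _ => by rw [h x w, hφ]
  have h1 : ∑ w, ∑ x, P.1 x w = Fintype.card V := by
    rw [Finset.sum_comm]
    simp [Matrix.sum_row_of_mem_rowStochastic P.2]
  simp_rw [h] at h1
  have hV : (0 : ℝ) < Fintype.card V := by exact_mod_cast Fintype.card_pos
  rw [Finset.sum_const, Finset.card_univ, nsmul_eq_mul] at h1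
  exact mul_left_cancel₀ hV.ne' (h1.trans (mul_one _).symm)

lemma IsTransitive.stationary_eq {P : Matrix.rowStochastic ℝ V} (hT : IsTransitive P)
    (hI : P.1.IsIrreducible) {π : V → ℝ} (hπ : IsStationary P π) (x : V) :
    π x = 1 / Fintype.card V := by
  have : Nonempty V := ⟨x⟩
  have hV : (0 : ℝ) < Fintype.card V := by exact_mod_cast Fintype.card_pos
  -- `π` is harmonic for the time reversal with respect to the uniform distribution
  have hP' : P.1.transpose ∈ Matrix.rowStochastic ℝ V :=
    Matrix.mem_rowStochastic_iff_sum.2 ⟨fun i j => P.2.1 j i, fun i => hT.sum_col i⟩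
  have hc := eq_of_harmonic hP' hI.transpose (f := π) <| funext fun y => by
    rw [← hπ.2.2 y]
    exact Finset.sum_congr rfl fun x _ => mul_comm (P.1 x y) (π x)
  have h1 := hπ.2.1
  simp_rw [fun y => hc y x] at h1
  rw [Finset.sum_const, Finset.card_univ, nsmul_eq_mul] at h1
  rw [eq_div_iff hV.ne', mul_comm]
  exact h1

lemma IsTransitive.isSymm {P : Matrix.rowStochastic ℝ V} (hT : IsTransitive P)
    (hI : P.1.IsIrreducible) {π : V → ℝ} (hπ : IsStationary P π) (hr : IsReversible P π) :
    P.1.IsSymm := by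
  ext x y
  have : Nonempty V := ⟨x⟩
  have hV : (0 : ℝ) < Fintype.card V := by exact_mod_cast Fintype.card_pos
  have h := hr y x
  rw [hT.stationary_eq hI hπ, hT.stationary_eq hI hπ] at h
  exact mul_left_cancel₀ (by positivity) h

/-- The eigenvalues of a lazy chain are nonnegative, and those of any chain are at most `1`. -/
lemma IsLazy.eigenvalue_mem_Icc {P : Matrix.rowStochastic ℝ V} (hL : IsLazy P) {l : ℝ}
    {f : V → ℝ} (hf0 : f ≠ 0) (hf : P.1.mulVec f = l • f) : 0 ≤ l ∧ l ≤ 1 := by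
  obtain ⟨R, hR⟩ := hL
  obtain ⟨z, hz⟩ := Function.ne_iff.1 hf0
  have : Nonempty V := ⟨z⟩
  obtain ⟨x, hx⟩ := Finite.exists_max fun x => |f x|
  have hx0 : 0 < |f x| := (abs_pos.2 hz).trans_le (hx z)
  have h1 : ∑ y, R.1 x y * f y = (2 * l - 1) * f x := by
    have h2 := congrFun hf x
    rw [hR, Matrix.smul_mulVec, Matrix.add_mulVec, Matrix.one_mulVec] at h2
    simp only [Pi.smul_apply, Pi.add_apply, smul_eq_mul] at h2
    have h3 : (R.1.mulVec f) x = ∑ y, R.1 x y * f y := rfl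
    linarith
  have h4 : |2 * l - 1| * |f x| ≤ 1 * |f x| := by
    rw [← abs_mul, ← h1, ← Matrix.sum_row_of_mem_rowStochastic R.2 x, Finset.sum_mul]
    refine (Finset.abs_sum_le_sum_abs _ _).trans (Finset.sum_le_sum fun y _ => ?_)
    rw [abs_mul, abs_of_nonneg (R.2.1 x y)]
    exact mul_le_mul_of_nonneg_left (hx y) (R.2.1 x y)
  have h5 := abs_le.1 (le_of_mul_le_mul_right h4 hx0)
  constructor <;> linarith [h5.1, h5.2]

/-- `l` lists the eigenvalues of the irreducible, transitive and lazy symmetric matrix `P`, with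
`l o = 1` the simple eigenvalue of the constant functions; together with what the argument needs to
know about them. -/
structure IsSpectrum (P : Matrix.rowStochastic ℝ V) (l : V → ℝ) (o : V) : Prop where
  one : l o = 1
  nonneg : ∀ i, 0 ≤ l i
  lt_one : ∀ i, i ≠ o → l i < 1
  trace_pow : ∀ k, (P.1 ^ k).trace = ∑ i, l i ^ k
  spectralSum_eq : spectralSum P = ∑ i ∈ Finset.univ.erase o, ((1 - l i) ^ 2)⁻¹
  eigen : ∀ i, ∃ f : V → ℝ, f ≠ 0 ∧ P.1.mulVec f = l i • f
  abs_le : ∀ k x y, |(P.1 ^ k) x y - 1 / Fintype.card V|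
    ≤ ((P.1 ^ k).trace - 1) / Fintype.card V

lemma pow_apply_eq_sum_eigenvalues {P : Matrix V V ℝ} (hH : P.IsHermitian) (k : ℕ) (x y : V) :
    (P ^ k) x y = ∑ i, hH.eigenvalues i ^ k
      * (hH.eigenvectorBasis i x * hH.eigenvectorBasis i y) := by
  conv_lhs => rw [hH.spectral_theorem, ← map_pow, Matrix.diagonal_pow]
  rw [Unitary.conjStarAlgAut_apply, Matrix.mul_apply]
  refine Finset.sum_congr rfl fun i _ => ?_
  rw [Matrix.mul_diagonal]
  simp [Matrix.star_apply]
  ring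

lemma sum_eigenvectorBasis_mul {P : Matrix V V ℝ} (hH : P.IsHermitian) (i j : V) :
    ∑ x, hH.eigenvectorBasis i x * hH.eigenvectorBasis j x = if i = j then 1 else 0 := by
  have h := orthonormal_iff_ite.1 hH.eigenvectorBasis.orthonormal i j
  rw [← h, PiLp.inner_apply]
  exact Finset.sum_congr rfl fun x _ => by simp [mul_comm]

lemma sum_eq_zero_of_mulVec_eq {P : Matrix V V ℝ} (hP : P ∈ Matrix.rowStochastic ℝ V)
    (hS : P.IsSymm) {l : ℝ} (hl : l ≠ 1) {f : V → ℝ} (hf : P.mulVec f = l • f) : ∑ x, f x = 0 := by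
  have h : ∑ x, ∑ y, P x y * f y = l * ∑ x, f x := by
    rw [Finset.mul_sum]
    exact Finset.sum_congr rfl fun x _ => congrFun hf x
  rw [Finset.sum_comm] at h
  have h1 := sum_col_pow hP hS 1
  simp only [pow_one] at h1
  simp_rw [← Finset.sum_mul, h1, one_mul] at h
  have h2 : (l - 1) * ∑ x, f x = 0 := by linarith
  exact (mul_eq_zero.1 h2).resolve_left (sub_ne_zero.2 hl)

lemma exists_isSpectrum {P : Matrix.rowStochastic ℝ V} (hI : P.1.IsIrreducible)
    (hS : P.1.IsSymm) (hL : IsLazy P) (hT : IsTransitive P) [Nonempty V] :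
    ∃ l o, IsSpectrum P l o := by
  have hH : P.1.IsHermitian := by
    rw [Matrix.IsHermitian, Matrix.conjTranspose_eq_transpose_of_trivial]
    exact hS
  have hV : (0 : ℝ) < Fintype.card V := by exact_mod_cast Fintype.card_pos
  set l := hH.eigenvalues with hl
  set e : V → V → ℝ := fun i x => hH.eigenvectorBasis i x with he
  have hpow : ∀ k x y, (P.1 ^ k) x y = ∑ i, l i ^ k * (e i x * e i y) :=
    pow_apply_eq_sum_eigenvalues hH
  have horth : ∀ i j, ∑ x, e i x * e j x = if i = j then 1 else 0 := sum_eigenvectorBasis_mul hH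
  have heig : ∀ i, P.1.mulVec (e i) = l i • e i := hH.mulVec_eigenvectorBasis
  have he0 : ∀ i, e i ≠ 0 := fun i h => by simpa [h] using horth i i
  have hmem : ∀ i, 0 ≤ l i ∧ l i ≤ 1 := fun i => hL.eigenvalue_mem_Icc (he0 i) (heig i)
  have hconst : ∀ i, l i = 1 → ∀ x y, e i x = e i y := fun i hi =>
    eq_of_harmonic P.2 hI (by rw [heig, hi, one_smul])
  obtain ⟨o, ho⟩ : ∃ o, l o = 1 := by
    by_contra! h
    obtain ⟨z⟩ := ‹Nonempty V›
    have h1 : ∑ y, (P.1 ^ 0) z y = 1 := sum_row_pow P.2 0 z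
    simp_rw [hpow] at h1
    rw [Finset.sum_comm] at h1
    simp_rw [← Finset.mul_sum, fun i => sum_eq_zero_of_mulVec_eq P.2 hS (h i) (heig i)] at h1
    simp at h1
  have hsq : ∀ i, l i = 1 → ∀ x y, e i x * e i y = 1 / Fintype.card V := by
    intro i hi x y
    have h := horth i i
    rw [if_pos rfl] at h
    simp_rw [fun z => hconst i hi z x] at h
    rw [Finset.sum_const, Finset.card_univ, nsmul_eq_mul] at h
    rw [hconst i hi y x, eq_div_iff hV.ne', mul_comm]
    exact h
  have huniq : ∀ i, i ≠ o → l i ≠ 1 := by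
    intro i hio hi
    have h := horth i o
    rw [if_neg hio] at h
    obtain ⟨z⟩ := ‹Nonempty V›
    simp_rw [fun w => hconst i hi w z, fun w => hconst o ho w z] at h
    rw [Finset.sum_const, Finset.card_univ, nsmul_eq_mul] at h
    have h1 := hsq i hi z z
    have h2 := hsq o ho z z
    have h3 : 0 < 1 / (Fintype.card V : ℝ) := by positivity
    rcases mul_eq_zero.1 ((mul_eq_zero.1 h).resolve_left hV.ne') with h | h
    · rw [h] at h1; linarith
    · rw [h] at h2; linarith
  have htr : ∀ k, (P.1 ^ k).trace = ∑ i, l i ^ k := by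
    intro k
    simp only [Matrix.trace, Matrix.diag_apply, hpow]
    rw [Finset.sum_comm]
    simp_rw [← Finset.mul_sum, horth]
    simp
  refine ⟨l, o, ho, fun i => (hmem i).1, fun i hi => lt_of_le_of_ne (hmem i).2 (huniq i hi), htr,
    ?_, fun i => ⟨e i, he0 i, heig i⟩, ?_⟩
  · rw [spectralSum, nonUnitEigenvalues, hH.roots_charpoly_eq_eigenvalues, Multiset.filter_map,
      Multiset.map_map]
    have h : Finset.univ.erase o = Finset.univ.filter fun i => l i ≠ 1 := by
      ext i
      simp only [Finset.mem_erase, Finset.mem_univ, and_true, Finset.mem_filter, true_and]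
      exact ⟨huniq i, fun h hi => h (hi ▸ ho)⟩
    rw [h, Finset.sum, Finset.filter_val]
    rfl
  · intro k x y
    have hsplit : ∀ x y, (P.1 ^ k) x y - 1 / Fintype.card V
        = ∑ i ∈ Finset.univ.erase o, l i ^ k * (e i x * e i y) := by
      intro x y
      rw [hpow, ← Finset.add_sum_erase _ _ (Finset.mem_univ o), ho, hsq o ho]
      ring
    have hdiag : ∀ x, ∑ i ∈ Finset.univ.erase o, l i ^ k * (e i x * e i x)
        = ((P.1 ^ k).trace - 1) / Fintype.card V := by
      intro x
      rw [← hsplit, ← hT.card_mul_pow_apply k x]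
      field_simp
    rw [hsplit]
    calc _ ≤ ∑ i ∈ Finset.univ.erase o,
          (l i ^ k * (e i x * e i x) + l i ^ k * (e i y * e i y)) / 2 := by
          refine (Finset.abs_sum_le_sum_abs _ _).trans (Finset.sum_le_sum fun i _ => ?_)
          have h0 := pow_nonneg (hmem i).1 k
          rw [abs_mul, abs_of_nonneg h0, ← mul_add, mul_div_assoc]
          refine mul_le_mul_of_nonneg_left (_root_.abs_le.2 ⟨?_, ?_⟩) h0
          · nlinarith [sq_nonneg (e i x + e i y)]
          · nlinarith [sq_nonneg (e i x - e i y)]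
      _ = _ := by
          rw [← Finset.sum_div, Finset.sum_add_distrib, hdiag, hdiag]
          ring

namespace IsSpectrum

variable {P : Matrix.rowStochastic ℝ V} {l : V → ℝ} {o : V}

lemma traceSum_eq (h : IsSpectrum P l o) (t : ℕ) :
    traceSum P.1 t = ∑ i, (∑ a ∈ Finset.range (t + 1), l i ^ a) ^ 2 := by
  have hsq : ∀ i, (∑ a ∈ Finset.range (t + 1), l i ^ a) ^ 2
      = ∑ a ∈ Finset.range (t + 1), ∑ b ∈ Finset.range (t + 1), l i ^ (a + b) := fun i => by
    simp only [sq, Finset.sum_mul_sum, pow_add]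
  simp_rw [traceSum, h.trace_pow, hsq]
  rw [Finset.sum_comm (s := Finset.univ)]
  exact Finset.sum_congr rfl fun a _ => Finset.sum_comm

lemma traceSum_eq_add (h : IsSpectrum P l o) (t : ℕ) : traceSum P.1 t = ((t : ℝ) + 1) ^ 2
    + ∑ i ∈ Finset.univ.erase o, (1 - l i ^ (t + 1)) ^ 2 * ((1 - l i) ^ 2)⁻¹ := by
  rw [h.traceSum_eq, ← Finset.add_sum_erase _ _ (Finset.mem_univ o), h.one]
  congr 1
  · simp
  · refine Finset.sum_congr rfl fun i hi => ?_
    have hi1 := h.lt_one i (Finset.ne_of_mem_erase hi)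
    have hi2 : 1 - l i ≠ 0 := by linarith
    have h2 := geom_sum_mul_neg (l i) (t + 1)
    rw [← h2]
    field_simp

lemma spectralSum_nonneg (h : IsSpectrum P l o) : 0 ≤ spectralSum P := by
  rw [h.spectralSum_eq]
  exact Finset.sum_nonneg fun i _ => by positivity

lemma one_le_spectralSum (h : IsSpectrum P l o) (hV : 2 ≤ Fintype.card V) : 1 ≤ spectralSum P := by
  have : Nontrivial V := Fintype.one_lt_card_iff_nontrivial.1 hV
  obtain ⟨i, hi⟩ := exists_ne o
  rw [h.spectralSum_eq]
  refine le_trans ?_ (Finset.single_le_sum (f := fun i => ((1 - l i) ^ 2)⁻¹)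
    (fun i _ => by positivity) (Finset.mem_erase.2 ⟨hi, Finset.mem_univ i⟩))
  have h1 := h.lt_one i hi
  have h0 := h.nonneg i
  exact (one_le_inv₀ (by have : 0 < 1 - l i := by linarith
                         positivity)).2 (by nlinarith)

lemma traceSum_le (h : IsSpectrum P l o) (t : ℕ) :
    traceSum P.1 t ≤ ((t : ℝ) + 1) ^ 2 + spectralSum P := by
  rw [h.traceSum_eq_add, h.spectralSum_eq]
  refine add_le_add le_rfl (Finset.sum_le_sum fun i hi => ?_)
  have h1 := h.lt_one i (Finset.ne_of_mem_erase hi)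
  have h0 := pow_nonneg (h.nonneg i) (t + 1)
  have h2 := pow_le_one₀ (h.nonneg i) h1.le (n := t + 1)
  exact mul_le_of_le_one_left (by positivity) (by nlinarith)

lemma mul_spectralSum_le (h : IsSpectrum P l o) {t : ℕ} {r : ℝ} (hr : r ≤ 1)
    (ht : ∀ i, i ≠ o → l i ^ (t + 1) ≤ r) : (1 - r) ^ 2 * spectralSum P ≤ traceSum P.1 t := by
  rw [h.traceSum_eq_add, h.spectralSum_eq, Finset.mul_sum]
  refine le_add_of_nonneg_of_le (by positivity) (Finset.sum_le_sum fun i hi => ?_)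
  refine mul_le_mul_of_nonneg_right ?_ (by positivity)
  exact pow_le_pow_left₀ (by linarith) (by linarith [ht i (Finset.ne_of_mem_erase hi)]) 2

lemma traceSum_pos (h : IsSpectrum P l o) (t : ℕ) : 0 < traceSum P.1 t := by
  rw [h.traceSum_eq_add]
  have : 0 ≤ ∑ i ∈ Finset.univ.erase o, (1 - l i ^ (t + 1)) ^ 2 * ((1 - l i) ^ 2)⁻¹ :=
    Finset.sum_nonneg fun i _ => by positivity
  positivity

lemma traceSum_add_self_le (h : IsSpectrum P l o) (t : ℕ) :
    traceSum P.1 (t + t) ≤ 4 * traceSum P.1 t := by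
  rw [h.traceSum_eq, h.traceSum_eq, Finset.mul_sum]
  refine Finset.sum_le_sum fun i _ => ?_
  have h0 := h.nonneg i
  have h1 : l i ≤ 1 := by
    by_cases hi : i = o
    · rw [hi, h.one]
    · exact (h.lt_one i hi).le
  have hs : 0 ≤ ∑ a ∈ Finset.range (t + 1), l i ^ a := Finset.sum_nonneg fun a _ => pow_nonneg h0 a
  have h2 : ∑ a ∈ Finset.range (t + t + 1), l i ^ a
      ≤ 2 * ∑ a ∈ Finset.range (t + 1), l i ^ a := by
    calc _ ≤ ∑ a ∈ Finset.range (t + 1 + (t + 1)), l i ^ a :=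
          Finset.sum_le_sum_of_subset_of_nonneg (Finset.range_subset_range.2 (by omega))
            fun a _ _ => pow_nonneg h0 a
      _ = (1 + l i ^ (t + 1)) * ∑ a ∈ Finset.range (t + 1), l i ^ a := by
          rw [Finset.sum_range_add, add_mul, one_mul, Finset.mul_sum]
          simp_rw [pow_add (l i) (t + 1)]
      _ ≤ _ := mul_le_mul_of_nonneg_right (by linarith [pow_le_one₀ h0 h1 (n := t + 1)]) hs
  calc _ ≤ (2 * ∑ a ∈ Finset.range (t + 1), l i ^ a) ^ 2 :=
        pow_le_pow_left₀ (Finset.sum_nonneg fun a _ => pow_nonneg h0 a) h2 2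
    _ = _ := by ring

/-- Each term of the trace satisfies `s l^s (1 - l) ≤ (1 - l) ∑_{a < s} l^a ≤ 1`. -/
lemma sq_mul_trace_sub_one_le (h : IsSpectrum P l o) (s : ℕ) :
    (s : ℝ) ^ 2 * ((P.1 ^ (s + s)).trace - 1) ≤ spectralSum P := by
  rw [h.trace_pow, h.spectralSum_eq, ← Finset.add_sum_erase _ _ (Finset.mem_univ o), h.one,
    one_pow, add_sub_cancel_left, Finset.mul_sum]
  refine Finset.sum_le_sum fun i hi => ?_
  have h0 := h.nonneg i
  have h1 : 0 < 1 - l i := by linarith [h.lt_one i (Finset.ne_of_mem_erase hi)]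
  have h2 : s * l i ^ s * (1 - l i) ≤ 1 := by
    have h3 := geom_sum_mul_neg (l i) s
    have h4 : s * l i ^ s ≤ ∑ a ∈ Finset.range s, l i ^ a := by
      have := Finset.card_nsmul_le_sum (Finset.range s) (fun a => l i ^ a) (l i ^ s) fun a ha =>
        pow_le_pow_of_le_one h0 (by linarith) (Finset.mem_range.1 ha).le
      simpa using this
    nlinarith [pow_nonneg h0 s, mul_le_mul_of_nonneg_right h4 h1.le]
  have h5 : 0 ≤ s * l i ^ s * (1 - l i) := by positivity
  rw [← one_div, le_div_iff₀ (by positivity)]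
  calc _ = (s * l i ^ s * (1 - l i)) ^ 2 := by ring
    _ ≤ 1 := pow_le_one₀ h5 h2

lemma pow_le_trace_sub_one (h : IsSpectrum P l o) (k : ℕ) {i : V} (hi : i ≠ o) :
    l i ^ k ≤ (P.1 ^ k).trace - 1 := by
  rw [h.trace_pow, ← Finset.add_sum_erase _ _ (Finset.mem_univ o), h.one,
    one_pow, add_sub_cancel_left]
  exact Finset.single_le_sum (f := fun i => l i ^ k) (fun i _ => pow_nonneg (h.nonneg i) k)
    (Finset.mem_erase.2 ⟨hi, Finset.mem_univ i⟩)

/-- The uniform distance to stationarity at time `t` is `tr P^t - 1`, attained on the diagonal. -/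
lemma unifMixing_iff (h : IsSpectrum P l o) (hT : IsTransitive P) {π : V → ℝ}
    (hπ : ∀ x, π x = 1 / Fintype.card V) (t : ℕ) :
    (∀ x y, |stepProb P t x y / π y - 1| ≤ 1 / 4) ↔ (P.1 ^ t).trace - 1 ≤ 1 / 4 := by
  have hV : (0 : ℝ) < Fintype.card V := by exact_mod_cast Fintype.card_pos_iff.2 ⟨o⟩
  have key : ∀ x y, stepProb P t x y / π y - 1
      = Fintype.card V * ((P.1 ^ t) x y - 1 / Fintype.card V) := fun x y => by
    rw [hπ, stepProb]
    field_simp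
  constructor
  · intro hxy
    have h1 := (le_abs_self _).trans (hxy o o)
    rw [key, mul_sub, hT.card_mul_pow_apply, mul_one_div_cancel hV.ne'] at h1
    exact h1
  · intro htr x y
    rw [key, abs_mul, abs_of_pos hV]
    have h1 := mul_le_mul_of_nonneg_left (h.abs_le t x y) hV.le
    rw [mul_div_cancel₀ _ hV.ne'] at h1
    exact h1.trans htr

lemma trace_sub_one_le_of_le (h : IsSpectrum P l o) {s : ℕ}
    (hs : 4 * spectralSum P ≤ (s : ℝ) ^ 2) (hs0 : 0 < s) : (P.1 ^ (s + s)).trace - 1 ≤ 1 / 4 := by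
  have h1 := h.sq_mul_trace_sub_one_le s
  have h2 : (0 : ℝ) < (s : ℝ) ^ 2 := by positivity
  refine le_of_mul_le_mul_left ?_ h2
  linarith

lemma exists_spectralSum_le_sq (h : IsSpectrum P l o) (hV : 2 ≤ Fintype.card V) :
    ∃ s : ℕ, 0 < s ∧ 4 * spectralSum P ≤ (s : ℝ) ^ 2 ∧ (s : ℝ) ≤ 3 * √(spectralSum P) := by
  have hQ := h.one_le_spectralSum hV
  have h1 : 1 ≤ √(spectralSum P) := Real.one_le_sqrt.2 hQ
  have hsq := Real.sq_sqrt h.spectralSum_nonneg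
  refine ⟨⌈2 * √(spectralSum P)⌉₊, Nat.ceil_pos.2 (by linarith), ?_, ?_⟩
  · have h2 := Nat.le_ceil (2 * √(spectralSum P))
    nlinarith
  · have h2 := Nat.ceil_lt_add_one (show 0 ≤ 2 * √(spectralSum P) by linarith)
    linarith

lemma trace_unifMixingTime (h : IsSpectrum P l o) (hT : IsTransitive P) (hV : 2 ≤ Fintype.card V)
    {π : V → ℝ} (hπ : ∀ x, π x = 1 / Fintype.card V) :
    (P.1 ^ unifMixingTime P π).trace - 1 ≤ 1 / 4 := by
  obtain ⟨s, hs0, hs, -⟩ := h.exists_spectralSum_le_sq hV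
  refine (h.unifMixing_iff hT hπ _).1 (Nat.sInf_mem
    (s := {t : ℕ | ∀ x y, |stepProb P t x y / π y - 1| ≤ 1 / 4}) ⟨s + s, ?_⟩)
  exact (h.unifMixing_iff hT hπ _).2 (h.trace_sub_one_le_of_le hs hs0)

lemma unifMixingTime_le (h : IsSpectrum P l o) (hT : IsTransitive P) (hV : 2 ≤ Fintype.card V)
    {π : V → ℝ} (hπ : ∀ x, π x = 1 / Fintype.card V) :
    (unifMixingTime P π : ℝ) ≤ 6 * √(spectralSum P) := by
  obtain ⟨s, hs0, hs, hs1⟩ := h.exists_spectralSum_le_sq hV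
  have h1 : unifMixingTime P π ≤ s + s :=
    Nat.sInf_le ((h.unifMixing_iff hT hπ _).2 (h.trace_sub_one_le_of_le hs hs0))
  have h2 : (unifMixingTime P π : ℝ) ≤ s + s := by exact_mod_cast h1
  linarith

/-- `Q` is comparable with the trace sum up to the uniform mixing time. -/
lemma spectralSum_le_traceSum (h : IsSpectrum P l o) (hT : IsTransitive P)
    (hV : 2 ≤ Fintype.card V) {π : V → ℝ} (hπ : ∀ x, π x = 1 / Fintype.card V) :
    spectralSum P ≤ 2 * traceSum P.1 (unifMixingTime P π) := by
  have h1 := h.trace_unifMixingTime hT hV hπ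
  have h2 := h.mul_spectralSum_le (t := unifMixingTime P π) (r := 1 / 4) (by norm_num)
    fun i hi => (pow_le_pow_of_le_one (h.nonneg i) (h.lt_one i hi).le (Nat.le_succ _)).trans
      ((h.pow_le_trace_sub_one _ hi).trans h1)
  linarith [h.spectralSum_nonneg]

lemma traceSum_le_spectralSum (h : IsSpectrum P l o) (hT : IsTransitive P)
    (hV : 2 ≤ Fintype.card V) {π : V → ℝ} (hπ : ∀ x, π x = 1 / Fintype.card V) :
    traceSum P.1 (unifMixingTime P π) ≤ 50 * spectralSum P := by
  have h1 := h.unifMixingTime_le hT hV hπ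
  have h2 := h.traceSum_le (unifMixingTime P π)
  have hQ := h.one_le_spectralSum hV
  have h3 : 1 ≤ √(spectralSum P) := Real.one_le_sqrt.2 hQ
  have hsq := Real.sq_sqrt h.spectralSum_nonneg
  have h4 : (unifMixingTime P π : ℝ) + 1 ≤ 7 * √(spectralSum P) := by linarith
  have h5 := pow_le_pow_left₀ (by positivity) h4 2
  rw [mul_pow, hsq] at h5
  linarith

end IsSpectrum

end Spectrum

/-! ### The law of the chain and finite-horizon expectations -/

section Law

variable {V : Type*} [Fintype V] [MeasurableSpace V] [DiscreteMeasurableSpace V]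

lemma measurable_of_dependsOn {α : Type*} [MeasurableSpace α] {f : (ℕ → V) → α} {n : ℕ}
    (hf : DependsOn f (Set.Iic n)) : Measurable f := by
  let g : (Finset.Iic n → V) → α := fun z => f fun k => z ⟨min k n, by simp⟩
  have : f = g ∘ Preorder.frestrictLe (π := fun _ : ℕ => V) n := by
    ext ω
    refine hf fun k hk => ?_
    simp [min_eq_left (Set.mem_Iic.1 hk)]
  rw [this]
  exact (Measurable.of_discrete (f := g)).comp (Preorder.measurable_frestrictLe n)

lemma measurable_prod_of_dependsOn {α : Type*} [MeasurableSpace α]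
    {f : (ℕ → V) → (ℕ → V) → α} {n : ℕ} (hf : ∀ Y, DependsOn (fun X => f X Y) (Set.Iic n))
    (hf' : ∀ X, DependsOn (f X) (Set.Iic n)) :
    Measurable (fun ω : (ℕ → V) × (ℕ → V) => f ω.1 ω.2) := by
  let r : (Finset.Iic n → V) → ℕ → V := fun z k => z ⟨min k n, by simp⟩
  let g : (Finset.Iic n → V) × (Finset.Iic n → V) → α := fun z => f (r z.1) (r z.2)
  let φ := Preorder.frestrictLe (π := fun _ : ℕ => V) n
  have hr : ∀ ω : ℕ → V, ∀ k ∈ Set.Iic n, ω k = r (φ ω) k := fun ω k hk => by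
    simp [r, φ, min_eq_left (Set.mem_Iic.1 hk)]
  have : (fun ω : (ℕ → V) × (ℕ → V) => f ω.1 ω.2) = g ∘ fun ω => (φ ω.1, φ ω.2) := by
    ext ω
    exact (hf ω.2 (hr ω.1)).trans (hf' _ (hr ω.2))
  rw [this]
  have hφ : Measurable φ := Preorder.measurable_frestrictLe n
  exact (Measurable.of_discrete (f := g)).comp
    ((hφ.comp measurable_fst).prodMk (hφ.comp measurable_snd))

variable [DecidableEq V]

lemma lintegral_stepKernel (P : Matrix.rowStochastic ℝ V) (x : V) (f : V → ℝ≥0∞) :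
    ∫⁻ y, f y ∂stepKernel P x = ∑ y, ENNReal.ofReal (P.1 x y) * f y := by
  have h : stepKernel P x = ∑ y, ENNReal.ofReal (P.1 x y) • Measure.dirac y := rfl
  rw [h, lintegral_finsetSum_measure]
  simp [lintegral_smul_measure]

lemma lmarginalPartialTraj_eq_pathExp (P : Matrix.rowStochastic ℝ V) (n : ℕ) (x : V)
    {F : (ℕ → V) → ℝ} (hF : DependsOn F (Set.Iic n)) (hF0 : ∀ ω, 0 ≤ F ω) :
    Kernel.lmarginalPartialTraj (X := fun _ => V) (historyKernel P) 0 n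
      (fun ω => ENNReal.ofReal (F ω)) (fun _ => x) = ENNReal.ofReal (pathExp P.1 n x F) := by
  induction n generalizing F with
  | zero =>
    rw [Kernel.lmarginalPartialTraj_le _ le_rfl]
    · rfl
    · exact (measurable_of_dependsOn hF).ennreal_ofReal
  | succ n ih =>
    have hmeas : Measurable fun ω => ENNReal.ofReal (F ω) :=
      (measurable_of_dependsOn hF).ennreal_ofReal
    rw [← Kernel.lmarginalPartialTraj_self (Nat.zero_le n) (Nat.le_succ n) hmeas]
    -- integrate out the last step
    set G : (ℕ → V) → ℝ := fun ω => ∑ y, P.1 (ω n) y * F (Function.update ω (n + 1) y) with hG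
    have h1 : Kernel.lmarginalPartialTraj (X := fun _ => V) (historyKernel P) n (n + 1)
        (fun ω => ENNReal.ofReal (F ω)) = fun ω => ENNReal.ofReal (G ω) := by
      ext ω
      rw [Kernel.lmarginalPartialTraj_succ n hmeas, hG,
        ENNReal.ofReal_sum_of_nonneg fun y _ => mul_nonneg (P.2.1 _ _) (hF0 _)]
      simp_rw [ENNReal.ofReal_mul (P.2.1 _ _)]
      exact lintegral_stepKernel P (ω n)
        fun y => ENNReal.ofReal (F (Function.update ω (n + 1) y))
    rw [h1, ih]
    · congr 1
      rw [pathExp_add_eq]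
      refine pathExp_congr P.1 n x fun ω _ => ?_
      simp only [pathExp, hG]
      refine Finset.sum_congr rfl fun y _ => congrArg _ (hF fun k hk => ?_)
      rcases (Set.mem_Iic.1 hk).lt_or_eq with hk | rfl
      · rw [Function.update_of_ne hk.ne,
          splice_of_le (consPath_zero _ _) (Nat.lt_succ_iff.1 hk)]
      · rw [Function.update_self, splice_add]
        rfl
    · intro ω ω' h
      refine Finset.sum_congr rfl fun y _ => ?_
      rw [h n (Set.mem_Iic.2 le_rfl)]
      refine congrArg _ (hF fun k hk => ?_)
      rcases (Set.mem_Iic.1 hk).lt_or_eq with hk | rfl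
      · rw [Function.update_of_ne hk.ne, Function.update_of_ne hk.ne]
        exact h k (Set.mem_Iic.2 (Nat.lt_succ_iff.1 hk))
      · rw [Function.update_self, Function.update_self]
    · exact fun ω => Finset.sum_nonneg fun y _ => mul_nonneg (P.2.1 _ _) (hF0 _)

lemma lintegral_chainLaw (P : Matrix.rowStochastic ℝ V) (n : ℕ) (x : V)
    {F : (ℕ → V) → ℝ} (hF : DependsOn F (Set.Iic n)) (hF0 : ∀ ω, 0 ≤ F ω) :
    ∫⁻ ω, ENNReal.ofReal (F ω) ∂chainLaw P x = ENNReal.ofReal (pathExp P.1 n x F) := by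
  have hmeas : Measurable fun ω => ENNReal.ofReal (F ω) :=
    (measurable_of_dependsOn hF).ennreal_ofReal
  rw [← lmarginalPartialTraj_eq_pathExp P n x hF hF0, Kernel.lmarginalPartialTraj,
    ← Kernel.traj_map_frestrictLe_apply, lintegral_map]
  · refine lintegral_congr fun ω => ?_
    refine congrArg _ (hF fun k hk => ?_)
    simp [Function.updateFinset, Set.mem_Iic.1 hk]
  · exact hmeas.comp measurable_updateFinset
  · exact Preorder.measurable_frestrictLe n

instance (P : Matrix.rowStochastic ℝ V) (x : V) : IsProbabilityMeasure (chainLaw P x) := by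
  unfold chainLaw
  infer_instance

lemma lintegral_pairLaw (P : Matrix.rowStochastic ℝ V) (n : ℕ) (x y : V)
    {F : (ℕ → V) → (ℕ → V) → ℝ} (hF : ∀ Y, DependsOn (fun X => F X Y) (Set.Iic n))
    (hF' : ∀ X, DependsOn (F X) (Set.Iic n)) (hF0 : ∀ X Y, 0 ≤ F X Y) :
    ∫⁻ ω, ENNReal.ofReal (F ω.1 ω.2) ∂pairLaw P x y = ENNReal.ofReal (pairExp P.1 n x y F) := by
  rw [pairLaw, lintegral_prod _ (measurable_prod_of_dependsOn hF hF').ennreal_ofReal.aemeasurable]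
  simp_rw [fun X => lintegral_chainLaw P n y (hF' X) (hF0 X)]
  rw [lintegral_chainLaw P n x]
  · rfl
  · exact fun X X' h => congrArg (pathExp P.1 n y) (funext fun Y => hF Y h)
  · exact fun X => pathExp_nonneg P.2.1 n y (hF0 X)

lemma lintegral_missInd (P : Matrix.rowStochastic ℝ V) (t : ℕ) (x y : V) :
    ∫⁻ ω, ENNReal.ofReal (missInd t ω.1 ω.2) ∂pairLaw P x y
      = ENNReal.ofReal (missProb P.1 t x y) :=
  lintegral_pairLaw P t x y (missInd_dependsOn_left t) (missInd_dependsOn_right t)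
    fun X Y => missInd_nonneg t X Y

lemma expectedIntersections_eq (P : Matrix.rowStochastic ℝ V) (t : ℕ) (x : V) :
    expectedIntersections P t x = ENNReal.ofReal (pairExp P.1 t x x (interCount t)) := by
  rw [expectedIntersections, ← lintegral_pairLaw P t x x (interCount_dependsOn_left t)
    (interCount_dependsOn_right t) fun X Y => interCount_nonneg t X Y]
  refine lintegral_congr fun ω => ?_
  rw [← ENNReal.ofReal_natCast]
  congr 1
  simp [numIntersections, interCount]

end Law

/-! ### The intersection time -/

section Time

variable {V : Type*}

lemma meets_iff (t : ℕ) (X Y : ℕ → V) :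
    ((X '' Set.Iic t) ∩ (Y '' Set.Iic t)).Nonempty ↔ Meets t X Y := by
  constructor
  · rintro ⟨_, ⟨i, hi, rfl⟩, ⟨j, hj, h⟩⟩
    exact ⟨i, hi, j, hj, h.symm⟩
  · rintro ⟨i, hi, j, hj, h⟩
    exact ⟨X i, ⟨i, hi, rfl⟩, ⟨j, hj, h.symm⟩⟩

lemma firstIntersection_le_of_meets {t : ℕ} {X Y : ℕ → V} (h : Meets t X Y) :
    firstIntersection X Y ≤ t := iInf₂_le t ((meets_iff t X Y).2 h)

lemma firstIntersection_le_tsum (X Y : ℕ → V) :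
    firstIntersection X Y ≤ ∑' N, ENNReal.ofReal (missInd N X Y) := by
  classical
  by_cases h : ∃ t, Meets t X Y
  · refine (firstIntersection_le_of_meets (Nat.find_spec h)).trans ?_
    refine le_trans (le_of_eq ?_) (ENNReal.sum_le_tsum (Finset.range (Nat.find h)))
    rw [Finset.sum_congr rfl (g := fun _ => (1 : ℝ≥0∞)) fun N hN => ?_]
    · simp
    · simp [missInd, Nat.find_min h (Finset.mem_range.1 hN)]
  · push Not at h
    have : ∑' N, ENNReal.ofReal (missInd N X Y) = ∞ := by
      simp [missInd, h]
    rw [this]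
    exact le_top

lemma mul_missInd_le_firstIntersection (N : ℕ) (X Y : ℕ → V) :
    ((N + 1 : ℕ) : ℝ≥0∞) * ENNReal.ofReal (missInd N X Y) ≤ firstIntersection X Y := by
  by_cases h : Meets N X Y
  · simp [missInd_of_meets h]
  · refine le_iInf₂ fun t ht => ?_
    rw [meets_iff] at ht
    have hNt : N + 1 ≤ t := by
      by_contra hlt
      obtain ⟨i, hi, j, hj, hij⟩ := ht
      exact h ⟨i, by omega, j, by omega, hij⟩
    simpa [missInd, h] using (Nat.cast_le (α := ℝ≥0∞)).2 hNt

variable [Fintype V] [DecidableEq V] [MeasurableSpace V] [DiscreteMeasurableSpace V]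
variable {P : Matrix.rowStochastic ℝ V}

lemma lintegral_firstIntersection_le {C : ℝ} {x y : V}
    (h : ∀ K, ∑ N ∈ Finset.range K, missProb P.1 N x y ≤ C) :
    ∫⁻ ω, firstIntersection ω.1 ω.2 ∂pairLaw P x y ≤ ENNReal.ofReal C := by
  calc _ ≤ ∫⁻ ω, ∑' N, ENNReal.ofReal (missInd N ω.1 ω.2) ∂pairLaw P x y :=
        lintegral_mono fun ω => firstIntersection_le_tsum ω.1 ω.2
    _ = ∑' N, ENNReal.ofReal (missProb P.1 N x y) := by
        rw [lintegral_tsum fun N => (measurable_prod_of_dependsOn (missInd_dependsOn_left N)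
          (missInd_dependsOn_right N)).ennreal_ofReal.aemeasurable]
        simp_rw [lintegral_missInd]
    _ ≤ _ := by
        refine ENNReal.tsum_le_of_sum_range_le fun K => ?_
        rw [← ENNReal.ofReal_sum_of_nonneg fun N _ => missProb_nonneg P.2 N x y]
        exact ENNReal.ofReal_le_ofReal (h K)

lemma mul_missProb_le_intersectionTime (P : Matrix.rowStochastic ℝ V) (N : ℕ) (x y : V) :
    ENNReal.ofReal ((N + 1) * missProb P.1 N x y) ≤ intersectionTime P := by
  refine le_trans ?_ (le_iSup₂ (f := fun x y => ∫⁻ ω, firstIntersection ω.1 ω.2 ∂pairLaw P x y) x y)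
  rw [ENNReal.ofReal_mul (by positivity), ← lintegral_missInd,
    ← lintegral_const_mul _ (measurable_prod_of_dependsOn (missInd_dependsOn_left N)
      (missInd_dependsOn_right N)).ennreal_ofReal]
  refine lintegral_mono fun ω => le_trans (le_of_eq ?_)
    (mul_missInd_le_firstIntersection N ω.1 ω.2)
  rw [← ENNReal.ofReal_natCast]
  push_cast
  rfl

lemma intersectionTime_of_subsingleton [Subsingleton V] (P : Matrix.rowStochastic ℝ V) :
    intersectionTime P = 0 := by
  have h : ∀ X Y : ℕ → V, firstIntersection X Y = 0 := fun X Y => by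
    simpa using firstIntersection_le_of_meets (t := 0) (X := X) (Y := Y)
      ⟨0, le_rfl, 0, le_rfl, Subsingleton.elim _ _⟩
  simp [intersectionTime, h]

end Time

/-! ### Comparison of the intersection time with the spectral sum -/

section Comparison

variable {V : Type*} [Fintype V] [DecidableEq V] {P : Matrix.rowStochastic ℝ V}
  {l : V → ℝ} {o : V}

/-- An eigenfunction with eigenvalue different from `1`, normalised to have maximum `1`; it has mean
zero, hence a negative minimum. -/
lemma exists_normalised_eigenfunction (hS : P.1.IsSymm) {r : ℝ} (hr : r ≠ 1) {f : V → ℝ}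
    (hf0 : f ≠ 0) (hf : P.1.mulVec f = r • f) :
    ∃ (g : V → ℝ) (x y : V), (∀ z, ∑ w, P.1 z w * g w = r * g z) ∧ (∀ z, g z ≤ 1) ∧ g x = 1 ∧
      (∀ z, g y ≤ g z) ∧ g y < 0 := by
  obtain ⟨z, hz⟩ := Function.ne_iff.1 hf0
  have : Nonempty V := ⟨z⟩
  have hsum := sum_eq_zero_of_mulVec_eq P.2 hS hr hf
  obtain ⟨x, hx⟩ := Finite.exists_max f
  obtain ⟨y, hy⟩ := Finite.exists_min f
  have hx0 : 0 < f x := by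
    by_contra! h
    exact hz ((Finset.sum_eq_zero_iff_of_nonpos fun w _ => (hx w).trans h).1 hsum z
      (Finset.mem_univ z))
  have hy0 : f y < 0 := by
    by_contra! h
    exact hz ((Finset.sum_eq_zero_iff_of_nonneg fun w _ => h.trans (hy w)).1 hsum z
      (Finset.mem_univ z))
  refine ⟨fun w => f w / f x, x, y, fun w => ?_, fun w => (div_le_one hx0).2 (hx w),
    div_self hx0.ne', fun w => div_le_div_of_nonneg_right (hy w) hx0.le,
    div_neg_of_neg_of_pos hy0 hx0⟩
  have h1 : ∑ v, P.1 w v * f v = r * f w := congrFun hf w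
  simp_rw [← mul_div_assoc, ← Finset.sum_div, h1]

/-- If intersection by time `t` has probability at least `1/2` from every pair of starting points,
then `Q = O((t+1)²)`. -/
lemma spectralSum_le_of_half_le_meetProb (h : IsSpectrum P l o) (hS : P.1.IsSymm)
    (hT : IsTransitive P) {t : ℕ} (ht : ∀ x y, 1 / 2 ≤ meetProb P.1 t x y) :
    spectralSum P ≤ 73728 * ((t : ℝ) + 1) ^ 2 := by
  have hV : (0 : ℝ) < Fintype.card V := by exact_mod_cast Fintype.card_pos_iff.2 ⟨o⟩
  -- the chains can only intersect if the relaxation time is of order at most `t`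
  have hl : ∀ i, i ≠ o → l i ^ (t + 1) ≤ 5 / 6 := by
    intro i hi
    have h0 := h.nonneg i
    have h1 := h.lt_one i hi
    obtain ⟨f, hf0, hf⟩ := h.eigen i
    obtain ⟨g, x, y, hg, hg1, hx, hy, hy0⟩ := exists_normalised_eigenfunction hS h1.ne hf0 hf
    have h2 := (ht x y).trans (meetProb_le_of_eigenfunction P.2 h0 h1.le hg hg1 hx hy hy0 t)
    have h3 : l i ^ (t + 1) ≤ l i ^ t := pow_le_pow_of_le_one h0 h1.le (Nat.le_succ t)
    linarith
  have hQ := h.mul_spectralSum_le (t := t) (r := 5 / 6) (by norm_num) hl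
  have hH := h.traceSum_pos t
  have hsum : (Fintype.card V : ℝ) ^ 2 * (1 / 2) ≤ ∑ x, ∑ y, meetProb P.1 t x y := by
    have := Finset.sum_le_sum fun x (_ : x ∈ (Finset.univ : Finset V)) =>
      Finset.sum_le_sum fun y (_ : y ∈ (Finset.univ : Finset V)) => ht x y
    simp only [Finset.sum_const, Finset.card_univ, nsmul_eq_mul] at this
    linarith
  have h1 := sum_meetProb_mul_le P.2 hS hT.card_mul_pow_apply t
  have h2 := h.traceSum_add_self_le t
  set H := traceSum P.1 t with hHdef
  set n : ℝ := (Fintype.card V : ℝ) with hn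
  have h3 : n ^ 2 * (1 / 2) * H ^ 2 ≤ 64 * n ^ 2 * (2 * t + 1) ^ 2 * (4 * H) :=
    (mul_le_mul_of_nonneg_right hsum (sq_nonneg H)).trans
      (h1.trans (mul_le_mul_of_nonneg_left h2 (by positivity)))
  have h4 : H ≤ 512 * (2 * (t : ℝ) + 1) ^ 2 := by
    have h5 : 0 < n ^ 2 * H := by positivity
    refine le_of_mul_le_mul_left ?_ h5
    linarith
  have h6 : (2 * (t : ℝ) + 1) ^ 2 ≤ 4 * ((t : ℝ) + 1) ^ 2 := by
    nlinarith [Nat.cast_nonneg (α := ℝ) t]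
  linarith

/-- From any pair of starting points, the chains intersect by a time of order `√Q` with probability
bounded below: after the mixing time they are nearly stationary, and then the second moment method
applies. -/
lemma le_meetProb_of_sq_le (h : IsSpectrum P l o) (hS : P.1.IsSymm) {s : ℕ} (hs0 : 0 < s)
    (hs : 4 * spectralSum P ≤ (s : ℝ) ^ 2) (x y : V) :
    9 / 128 ≤ meetProb P.1 (s + s + s) x y := by
  have hne : Nonempty V := ⟨o⟩
  have hV : (0 : ℝ) < Fintype.card V := by exact_mod_cast Fintype.card_pos
  set n : ℝ := (Fintype.card V : ℝ) with hn
  have hmix : ∀ x z, 3 / (4 * n) ≤ (P.1 ^ (s + s)) x z := by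
    intro x z
    have h1 := (abs_le.1 (h.abs_le (s + s) x z)).1
    have h2 := div_le_div_of_nonneg_right (h.trace_sub_one_le_of_le hs hs0) hV.le
    have h3 : 3 / (4 * n) = 1 / n - 1 / 4 / n := by field_simp; norm_num
    rw [h3]
    linarith
  have hst : n ^ 2 / 8 ≤ ∑ z, ∑ w, meetProb P.1 s z w := by
    have h1 := card_sq_mul_le_sum_meetProb P.2 hS s
    have h2 := h.traceSum_le s
    have h3 : traceSum P.1 s ≤ 2 * ((s : ℝ) + 1) ^ 2 := by
      nlinarith [h.spectralSum_nonneg, Nat.cast_nonneg (α := ℝ) s]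
    have hp : 0 ≤ ∑ z, ∑ w, meetProb P.1 s z w := Finset.sum_nonneg fun z _ =>
      Finset.sum_nonneg fun w _ => meetProb_nonneg P.2 s z w
    have h4 : (0 : ℝ) < ((s : ℝ) + 1) ^ 2 := by positivity
    have h5 := mul_le_mul_of_nonneg_right h3 hp
    refine le_of_mul_le_mul_left ?_ h4
    linarith
  have h0 : 0 ≤ 3 / (4 * n) := by positivity
  calc (9 / 128 : ℝ) = 3 / (4 * n) * (3 / (4 * n)) * (n ^ 2 / 8) := by field_simp; norm_num
    _ ≤ 3 / (4 * n) * (3 / (4 * n)) * ∑ z, ∑ w, meetProb P.1 s z w :=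
        mul_le_mul_of_nonneg_left hst (by positivity)
    _ ≤ ∑ z, ∑ w, (P.1 ^ (s + s)) x z * (P.1 ^ (s + s)) y w * meetProb P.1 s z w := by
        simp only [Finset.mul_sum]
        refine Finset.sum_le_sum fun z _ => Finset.sum_le_sum fun w _ => ?_
        exact mul_le_mul_of_nonneg_right (mul_le_mul (hmix x z) (hmix y w) h0 (h0.trans (hmix x z)))
          (meetProb_nonneg P.2 s z w)
    _ ≤ _ := sum_mul_meetProb_le P.2 (s + s) s x y

lemma missProb_zero {x y : V} (hxy : x ≠ y) : missProb P.1 0 x y = 1 := by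
  have h : ¬ Meets 0 (fun _ => x) (fun _ => y) := by
    rintro ⟨i, -, j, -, hij⟩
    exact hxy hij
  simp [missProb, pairExp, pathExp, missInd, h]

variable [MeasurableSpace V] [DiscreteMeasurableSpace V]

lemma intersectionTime_le (h : IsSpectrum P l o) (hS : P.1.IsSymm) (hV : 2 ≤ Fintype.card V) :
    intersectionTime P ≤ ENNReal.ofReal (128 * √(spectralSum P)) := by
  obtain ⟨s, hs0, hs, hs1⟩ := h.exists_spectralSum_le_sq hV
  refine iSup₂_le fun x y => lintegral_firstIntersection_le fun K => ?_
  have h1 := sum_missProb_le P.2 (T := s + s + s) (by omega) (ρ := 119 / 128) (by norm_num)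
    (fun x y => by linarith [le_meetProb_of_sq_le h hS hs0 hs x y,
      meetProb_add_missProb P.2 (s + s + s) x y]) K x y
  rw [show (1 : ℝ) - 119 / 128 = 9 / 128 by norm_num] at h1
  push_cast at h1
  linarith

lemma ofReal_sqrt_spectralSum_le (h : IsSpectrum P l o) (hS : P.1.IsSymm) (hT : IsTransitive P)
    (hV : 2 ≤ Fintype.card V) :
    ENNReal.ofReal (√(spectralSum P) / 1100) ≤ intersectionTime P := by
  rcases eq_or_ne (intersectionTime P) ∞ with htop | htop
  · rw [htop]
    exact le_top
  set T := (intersectionTime P).toReal with hTdef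
  -- Markov's inequality
  have hmark : ∀ (N : ℕ) x y, ((N : ℝ) + 1) * missProb P.1 N x y ≤ T := fun N x y =>
    (ENNReal.ofReal_le_iff_le_toReal htop).1 (mul_missProb_le_intersectionTime P N x y)
  have hT1 : 1 ≤ T := by
    have : Nontrivial V := Fintype.one_lt_card_iff_nontrivial.1 hV
    obtain ⟨x, y, hxy⟩ := exists_pair_ne V
    simpa [missProb_zero hxy] using hmark 0 x y
  have ht := Nat.le_ceil (2 * T)
  have ht' := Nat.ceil_lt_add_one (show 0 ≤ 2 * T by linarith)
  set t := ⌈2 * T⌉₊ with htdef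
  have hhalf : ∀ x y, 1 / 2 ≤ meetProb P.1 t x y := by
    intro x y
    have h1 := hmark t x y
    have h2 := meetProb_add_missProb P.2 t x y
    have h3 := missProb_nonneg P.2 t x y
    nlinarith
  have hQ := spectralSum_le_of_half_le_meetProb h hS hT hhalf
  rw [ENNReal.ofReal_le_iff_le_toReal htop, div_le_iff₀ (by norm_num)]
  refine Real.sqrt_le_iff.2 ⟨by positivity, ?_⟩
  have h4 : ((t : ℝ) + 1) ^ 2 ≤ (4 * T) ^ 2 := pow_le_pow_left₀ (by positivity) (by linarith) 2
  nlinarith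

end Comparison

end IntersectionTime

theorem theorem3 :
    ∃ c C : ℝ, 0 < c ∧ 0 < C ∧
      ∀ (V : Type*) [Fintype V] [DecidableEq V] [MeasurableSpace V] [DiscreteMeasurableSpace V]
        (P : Matrix.rowStochastic ℝ V) (π : V → ℝ),
        P.1.IsIrreducible →
        IntersectionTime.IsStationary P π →
        IntersectionTime.IsReversible P π →
        IntersectionTime.IsLazy P →
        IntersectionTime.IsTransitive P →
        (ENNReal.ofReal (c * √(IntersectionTime.spectralSum P))
            ≤ IntersectionTime.intersectionTime P ∧
          IntersectionTime.intersectionTime P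
            ≤ ENNReal.ofReal (C * √(IntersectionTime.spectralSum P))) ∧
        (2 ≤ Fintype.card V → ∀ x : V,
          (c * (Fintype.card V *
              ∑ i ∈ Finset.range (IntersectionTime.unifMixingTime P π + 1),
                ∑ j ∈ Finset.range (IntersectionTime.unifMixingTime P π + 1),
                  IntersectionTime.stepProb P (i + j) x x)
              ≤ IntersectionTime.spectralSum P ∧
            IntersectionTime.spectralSum P
              ≤ C * (Fintype.card V *
                ∑ i ∈ Finset.range (IntersectionTime.unifMixingTime P π + 1),
                  ∑ j ∈ Finset.range (IntersectionTime.unifMixingTime P π + 1),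
                    IntersectionTime.stepProb P (i + j) x x)) ∧
          (ENNReal.ofReal c * (Fintype.card V * IntersectionTime.expectedIntersections P
                (IntersectionTime.unifMixingTime P π) x) ^ (1 / 2 : ℝ)
              ≤ IntersectionTime.intersectionTime P ∧
            IntersectionTime.intersectionTime P
              ≤ ENNReal.ofReal C * (Fintype.card V * IntersectionTime.expectedIntersections P
                (IntersectionTime.unifMixingTime P π) x) ^ (1 / 2 : ℝ))) := by
  refine ⟨1 / 8800, 256, by norm_num, by norm_num, ?_⟩
  intro V _ _ _ _ P π hI hπ hr hL hT
  have hne : Nonempty V := by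
    by_contra hV
    rw [not_nonempty_iff] at hV
    simpa using hπ.2.1
  have hS := hT.isSymm hI hπ hr
  have hunif := hT.stationary_eq hI hπ
  obtain ⟨l, o, h⟩ := IntersectionTime.exists_isSpectrum hI hS hL hT
  have hQ0 := h.spectralSum_nonneg
  have hsq0 := Real.sqrt_nonneg (IntersectionTime.spectralSum P)
  constructor
  · rcases le_or_gt 2 (Fintype.card V) with hV | hV
    · exact ⟨(ENNReal.ofReal_le_ofReal (by linarith)).trans
          (IntersectionTime.ofReal_sqrt_spectralSum_le h hS hT hV),
        (IntersectionTime.intersectionTime_le h hS hV).trans (ENNReal.ofReal_le_ofReal (by linarith))⟩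
    · have hsub : Subsingleton V := Fintype.card_le_one_iff_subsingleton.1 (by omega)
      have hQ : IntersectionTime.spectralSum P = 0 := by
        rw [h.spectralSum_eq]
        exact Finset.sum_eq_zero fun i hi =>
          absurd (Subsingleton.elim i o) (Finset.ne_of_mem_erase hi)
      simp [hQ, IntersectionTime.intersectionTime_of_subsingleton P]
  · intro hV x
    set t := IntersectionTime.unifMixingTime P π with ht
    have hG : (Fintype.card V : ℝ) * ∑ i ∈ Finset.range (t + 1), ∑ j ∈ Finset.range (t + 1),
        IntersectionTime.stepProb P (i + j) x x = IntersectionTime.traceSum P.1 t := by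
      simp only [Finset.mul_sum, IntersectionTime.stepProb, hT.card_mul_pow_apply,
        IntersectionTime.traceSum]
    have hle := h.traceSum_le_spectralSum hT hV hunif
    have hge := h.spectralSum_le_traceSum hT hV hunif
    rw [← ht] at hle hge
    have hH := (h.traceSum_pos t).le
    have hE : ((Fintype.card V : ℝ≥0∞) * IntersectionTime.expectedIntersections P t x) ^ (1 / 2 : ℝ)
        = ENNReal.ofReal √(IntersectionTime.traceSum P.1 t) := by
      rw [IntersectionTime.expectedIntersections_eq,
        IntersectionTime.pairExp_interCount P.2 hS le_rfl, ← ENNReal.ofReal_natCast,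
        ← ENNReal.ofReal_mul (by positivity), Real.sqrt_eq_rpow,
        ← ENNReal.ofReal_rpow_of_nonneg hH (by norm_num)]
      exact congrArg (fun a => ENNReal.ofReal a ^ (1 / 2 : ℝ)) hG
    have hs1 : √(IntersectionTime.traceSum P.1 t) ≤ 8 * √(IntersectionTime.spectralSum P) := by
      rw [Real.sqrt_le_left (by positivity), mul_pow, Real.sq_sqrt hQ0]
      linarith
    have hs2 : √(IntersectionTime.spectralSum P) ≤ 2 * √(IntersectionTime.traceSum P.1 t) := by
      rw [Real.sqrt_le_left (by positivity), mul_pow, Real.sq_sqrt hH]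
      linarith
    rw [hG, hE, ← ENNReal.ofReal_mul (by norm_num), ← ENNReal.ofReal_mul (by norm_num)]
    refine ⟨⟨by linarith, by linarith⟩, ?_, ?_⟩
    · exact (ENNReal.ofReal_le_ofReal (by linarith)).trans
        (IntersectionTime.ofReal_sqrt_spectralSum_le h hS hT hV)
    · exact (IntersectionTime.intersectionTime_le h hS hV).trans
        (ENNReal.ofReal_le_ofReal (by linarith))
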